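/- Let $n\ge 0$, let $\omega$ be the standard symplectic form on $\mathbb{R}^{2n}=\mathbb{R}^n\oplus\mathbb{R}^n$, and let $\mathrm{Sp}(n)$ be the group of real $2n\times 2n$ matrices $\psi$ with $\omega(\psi v,\psi w)=\omega(v,w)$ for all $v,w$. Let $R=\begin{pmatrix}\mathbb 1&0\\0&-\mathbb 1\end{pmatrix}$, and put $$\mathrm{Sp}^R(n)=\{\psi\in\mathrm{Sp}(n)\mid \psi=R\psi^{-1}R\},\qquad \mathscr A(n)=\{S\in\mathrm{Gl}(2n,\mathbb{R})\mid S^2=\mathbb 1,\ \omega(Sv,Sw)=-\omega(v,w)\ \forall v,w\in\mathbb{R}^{2n}\}.$$ The map $A\mapsto\begin{pmatrix}A&0\\0&(A^T)^{-1}\end{pmatrix}$ is an injective homomorphism $\mathrm{Gl}(n,\mathbb{R})\to\mathrm{Sp}(n)$, and its image, again denoted $\mathrm{Gl}(n,\mathbb{R})$, is exactly $\{\psi\in\mathrm{Sp}(n)\mid R\psi=\psi R\}$. Moreover: (1) $\mathrm{Sp}(n)$, $\mathrm{Sp}^R(n)$ and $\mathscr A(n)$ are smooth embedded submanifolds of the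 vector space of real $2n\times 2n$ matrices, and the space $\mathrm{Gl}(n,\mathbb{R})\backslash\mathrm{Sp}(n)$ of cosets $\mathrm{Gl}(n,\mathbb{R})\psi$, with the quotient topology, carries a smooth manifold structure for which the projection $\mathrm{Sp}(n)\to\mathrm{Gl}(n,\mathbb{R})\backslash\mathrm{Sp}(n)$ is a smooth submersion. (2) For these smooth structures (that is, for any smooth structures with the properties in (1)) the three spaces $\mathrm{Sp}^R(n)$, $\mathscr A(n)$ and $\mathrm{Gl}(n,\mathbb{R})\backslash\mathrm{Sp}(n)$ are diffeomorphic: the map $\mathrm{Sp}^R(n)\to\mathscr A(n)$, $\psi\mapsto R\psi$, is a well-defined $C^\infty$ diffeomorphism, and the map $\mathrm{Sp}(n)\to\mathscr A(n)$, $\psi\mapsto\psi^{-1}R\psi$, descends to a well-defined $C^\infty$ diffeomorphism $\mathrm{Gl}(n,\mathbb{R})\backslash\mathrm{Sp}(n)\to\mathscr A(n)$. -/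

import Mathlib

open Matrix
open scoped Manifold ContDiff

/-- Real `2n × 2n` matrices, written in blocks along the splitting `ℝ²ⁿ = ℝⁿ ⊕ ℝⁿ`. -/
abbrev Mat (n : ℕ) : Type := Matrix (Fin n ⊕ Fin n) (Fin n ⊕ Fin n) ℝ

/-- The vector space `ℝ^(2n × 2n)` of arrays of matrix entries, a finite-dimensional normed space
(the choice of the norm is immaterial for smoothness). -/
abbrev Entries (n : ℕ) : Type := Fin n ⊕ Fin n → Fin n ⊕ Fin n → ℝ

/-- The linear identification of matrices with their arrays of entries. -/
def entries (n : ℕ) (M : Mat n) : Entries n := fun i j => M i j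

/-- The standard symplectic form `ω(v, w)` on `ℝ²ⁿ = ℝⁿ ⊕ ℝⁿ`. -/
def omega (n : ℕ) (v w : Fin n ⊕ Fin n → ℝ) : ℝ :=
  ∑ i : Fin n, (v (Sum.inl i) * w (Sum.inr i) - v (Sum.inr i) * w (Sum.inl i))

/-- The linear symplectic group `Sp(n)`, a group of `2n × 2n` matrices with the subspace
topology. -/
abbrev Sp (n : ℕ) : Type := ↥(Matrix.symplecticGroup (Fin n) ℝ)

/-- `omega` is, up to sign, the form of the matrix used in Mathlib's symplectic group. -/
theorem dotProduct_J_mulVec (n : ℕ) (v w : Fin n ⊕ Fin n → ℝ) :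
    v ⬝ᵥ (Matrix.J (Fin n) ℝ *ᵥ w) = -omega n v w := by
  have h : Matrix.J (Fin n) ℝ *ᵥ w = Sum.elim (fun i => -w (Sum.inr i)) (fun i => w (Sum.inl i)) := by
    ext i
    rcases i with i | i <;>
      simp [Matrix.J, Matrix.fromBlocks_mulVec, Matrix.neg_mulVec]
  rw [h, omega]
  simp [dotProduct, Fintype.sum_sum_type, Finset.sum_sub_distrib]
  ring

/-- A matrix lies in `Sp(n)` exactly when it preserves the standard symplectic form. -/
theorem mem_Sp_iff (n : ℕ) (ψ : Mat n) :
    ψ ∈ Matrix.symplecticGroup (Fin n) ℝ ↔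
      ∀ v w, omega n (ψ *ᵥ v) (ψ *ᵥ w) = omega n v w := by
  have key : ∀ v w, omega n (ψ *ᵥ v) (ψ *ᵥ w) =
      -(v ⬝ᵥ ((ψᵀ * Matrix.J (Fin n) ℝ * ψ) *ᵥ w)) := by
    intro v w
    rw [← neg_eq_iff_eq_neg, ← dotProduct_J_mulVec, ← Matrix.mulVec_mulVec,
      ← Matrix.mulVec_mulVec, Matrix.dotProduct_mulVec v, Matrix.vecMul_transpose]
  rw [SymplecticGroup.mem_iff']
  constructor
  · intro h v w
    rw [key, h, dotProduct_J_mulVec, neg_neg]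
  · intro h
    refine Matrix.ext_of_mulVec_single fun j => ?_
    refine dotProduct_eq _ _ fun v => ?_
    have h1 := h v (Pi.single j 1)
    have h2 := dotProduct_J_mulVec n v (Pi.single j 1)
    rw [key] at h1
    rw [dotProduct_comm, dotProduct_comm _ v]
    linarith

/-- The standard anti-symplectic involution `R = diag(1, -1)`. -/
def R (n : ℕ) : Mat n := Matrix.fromBlocks 1 0 0 (-1)

/-- The space `𝒜(n)` of linear anti-symplectic involutions of `ℝ²ⁿ`, with the subspace topology. -/
def AntiInv (n : ℕ) : Set (Mat n) :=
  {S | S * S = 1 ∧ ∀ v w, omega n (S *ᵥ v) (S *ᵥ w) = -omega n v w}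

/-- The space `Sp^R(n) = {ψ ∈ Sp(n) | ψ = R ψ⁻¹ R}`, with the subspace topology. -/
def SpR (n : ℕ) : Set (Mat n) :=
  {ψ | ψ ∈ Matrix.symplecticGroup (Fin n) ℝ ∧ ψ = R n * ψ⁻¹ * R n}

/-- The homomorphism `Gl(n, ℝ) → Sp(n)`, `A ↦ diag(A, (Aᵀ)⁻¹)`. -/
noncomputable def glHom (n : ℕ) : GL (Fin n) ℝ →* Sp n where
  toFun A := ⟨Matrix.fromBlocks (A : Matrix (Fin n) (Fin n) ℝ) 0 0
      ((A : Matrix (Fin n) (Fin n) ℝ)ᵀ)⁻¹, by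
    have hA : IsUnit ((A : Matrix (Fin n) (Fin n) ℝ)ᵀ).det := by
      rw [Matrix.det_transpose]
      exact (Matrix.isUnit_iff_isUnit_det _).mp A.isUnit
    rw [SymplecticGroup.fromBlocks_mem_iff]
    simp [Matrix.mul_nonsing_inv _ hA]⟩
  map_one' := by
    apply Subtype.ext
    simp
  map_mul' A B := by
    apply Subtype.ext
    simp [Matrix.fromBlocks_multiply, Matrix.transpose_mul, Matrix.mul_inv_rev]

/-- `Gl(n, ℝ)` as a subgroup of `Sp(n)`. -/
noncomputable def GlSub (n : ℕ) : Subgroup (Sp n) := (glHom n).range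

/-- The homogeneous space `Gl(n, ℝ) \ Sp(n)` of cosets `Gl(n, ℝ) ψ`, with the quotient topology. -/
abbrev HomSpace (n : ℕ) : Type := Quotient (QuotientGroup.rightRel (GlSub n))

/-- The projection `Sp(n) → Gl(n, ℝ) \ Sp(n)`, `ψ ↦ Gl(n, ℝ) ψ`. -/
noncomputable def proj (n : ℕ) (ψ : Sp n) : HomSpace n := Quotient.mk (QuotientGroup.rightRel (GlSub n)) ψ

/-- The given charts make the space `X`, mapped to matrices by `ι`, a smooth embedded submanifold
of the vector space of matrices. These conditions determine the smooth structure. -/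
structure IsSubmanifoldStructure {n : ℕ} {X : Type} [TopologicalSpace X] (ι : X → Mat n)
    {d : ℕ} (cX : ChartedSpace (EuclideanSpace ℝ (Fin d)) X) : Prop where
  isManifold : IsManifold (𝓡 d) ∞ X
  isSmoothEmbedding : Manifold.IsSmoothEmbedding (𝓡 d) 𝓘(ℝ, Entries n) ∞ (fun x : X => entries n (ι x))

/-- Given the charts of `Sp(n)`, the given charts of `Gl(n, ℝ) \ Sp(n)` make it a smooth manifold
such that the projection is a smooth submersion. These conditions determine the smooth structure of
the homogeneous space. -/
structure IsQuotientStructure {n : ℕ} {d e : ℕ}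
    (cS : ChartedSpace (EuclideanSpace ℝ (Fin d)) (Sp n))
    (cQ : ChartedSpace (EuclideanSpace ℝ (Fin e)) (HomSpace n)) : Prop where
  isManifold : IsManifold (𝓡 e) ∞ (HomSpace n)
  isSubmersion : Manifold.IsSubmersion (𝓡 d) (𝓡 e) ∞ (proj n)

/-! Conjugation by `Sp(n)` acts transitively on `𝒜(n)`. If `S` is an anti-symplectic involution, its
eigenspaces for `1` and `-1` are isotropic and span, so `ω` pairs them perfectly. A basis of one and
the dual basis of the other form a symplectic basis (`exists_symplectic_eigenbasis`), whence `S =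
ψ⁻¹Rψ` (`exists_sp_conj`). The stabiliser of `R` is its commutant `Gl(n, ℝ)` (`mem_GlSub_iff`), so
cosets correspond bijectively to elements of `𝒜(n)`.

Smoothness comes from explicit coordinates. A symplectic matrix with invertible lower right block is
uniquely `diag((δᵀ)⁻¹, δ) · (1 B; 0 1) · (1 0; C 1)` with `B`, `C` symmetric. The diagonal factor
commutes with `R`, so `ψ⁻¹Rψ` depends on `(B, C)` alone, and `(B, C)` are coordinates on `𝒜(n)` near
`R`. In these coordinates `ψ ↦ ψ⁻¹Rψ` is the projection `(δ, B, C) ↦ (B, C)`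
(`entries_conjR_of_eq_par`): this gives the submersion, and `δ = 1` gives a smooth local section.
Translating by `χ` covers all points. Each chart is a `SliceChart`, whose left inverse is smooth on
an ambient open set; this makes the parametrisation an immersion, and the inverse function theorem
yields embedded submanifolds.

For arbitrary structures as in (1), smoothness into a submanifold is tested in the space of
matrices, and smoothness out of the quotient is tested on `Sp(n)`. Left multiplication by `R` is a
linear automorphism of the matrices exchanging `Sp^R(n)` and `𝒜(n)`. -/

section

open Function Module Topology

/-! ### Straightening immersions by the inverse function theorem. -/

section Straightening

variable {E F V : Type} [NormedAddCommGroup E] [NormedSpace ℝ E] [FiniteDimensional ℝ E]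
  [NormedAddCommGroup F] [NormedSpace ℝ F] [FiniteDimensional ℝ F]
  [NormedAddCommGroup V] [NormedSpace ℝ V] [FiniteDimensional ℝ V]

/-- An injective linear map extends to an isomorphism from the sum of its source with any space
of complementary dimension. -/
theorem exists_equiv_prod_extending (f : E →ₗ[ℝ] V) (hf : Injective f)
    (hdim : finrank ℝ E + finrank ℝ F = finrank ℝ V) :
    ∃ L : (E × F) ≃L[ℝ] V, ∀ u, L (u, 0) = f u := by
  obtain ⟨C, hC⟩ := Submodule.exists_isCompl (LinearMap.range f)
  have h1 := Submodule.finrank_add_eq_of_isCompl hC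
  rw [LinearMap.finrank_range_of_inj hf] at h1
  have h2 : finrank ℝ F = finrank ℝ C := by omega
  refine ⟨(((LinearEquiv.ofInjective f hf).prodCongr (LinearEquiv.ofFinrankEq F C h2)).trans
    (Submodule.prodEquivOfIsCompl _ _ hC)).toContinuousLinearEquiv, fun u => ?_⟩
  simp

/-- An immersion `g` of an open set of a vector space is straightened by a local diffeomorphism of
the ambient vector space. -/
theorem exists_straightening {g : E → V} {U : Set E} (hU : IsOpen U) (hg : ContDiffOn ℝ ∞ g U)
    {u : E} (hu : u ∈ U) (hinj : Injective (fderiv ℝ g u))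
    (hdim : finrank ℝ E + finrank ℝ F = finrank ℝ V) :
    ∃ (L : (E × F) ≃L[ℝ] V) (Θ : OpenPartialHomeomorph V V), L (u, 0) ∈ Θ.source ∧
      (∀ w, Θ (L (w, 0)) = g w) ∧ ContDiffOn ℝ ∞ Θ Θ.source ∧ ContDiffOn ℝ ∞ Θ.symm Θ.target := by
  obtain ⟨L, hL⟩ := exists_equiv_prod_extending (F := F) (fderiv ℝ g u : E →ₗ[ℝ] V) hinj hdim
  -- In the coordinates of `L`, `G` is `(a, b) ↦ g a + L (0, b)`. Since `L (a, 0)` is the derivative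
  -- of `g` applied to `a`, the derivative of `G` at `L (u, 0)` is the identity.
  let p : V →L[ℝ] E := (ContinuousLinearMap.fst ℝ E F).comp (L.symm : V →L[ℝ] E × F)
  let q : V →L[ℝ] V := (L : E × F →L[ℝ] V).comp
    ((ContinuousLinearMap.inr ℝ E F).comp
      ((ContinuousLinearMap.snd ℝ E F).comp (L.symm : V →L[ℝ] E × F)))
  let G : V → V := fun y => g (p y) + q y
  let s : Set V := p ⁻¹' U
  have hs : IsOpen s := hU.preimage p.continuous
  have hp0 : p (L (u, 0)) = u := by simp [p]
  have hy0 : L (u, 0) ∈ s := by simpa [s, hp0] using hu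
  have hG : ContDiffOn ℝ ∞ G s :=
    (hg.comp p.contDiff.contDiffOn (fun y hy => hy)).add q.contDiff.contDiffOn
  have hGat : ∀ y ∈ s, ContDiffAt ℝ ∞ G y := fun y hy => hG.contDiffAt (hs.mem_nhds hy)
  have hd : HasFDerivAt G ((ContinuousLinearEquiv.refl ℝ V : V ≃L[ℝ] V) : V →L[ℝ] V)
      (L (u, 0)) := by
    have h1 : HasFDerivAt g (fderiv ℝ g u) (p (L (u, 0))) := by
      rw [hp0]
      exact ((hg.contDiffAt (hU.mem_nhds hu)).differentiableAt (by simp)).hasFDerivAt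
    have h2 := (h1.comp (L (u, 0)) p.hasFDerivAt).add q.hasFDerivAt
    refine h2.congr_fderiv ?_
    ext y
    obtain ⟨⟨a, b⟩, rfl⟩ := L.surjective y
    have : L (a, 0) + L (0, b) = L (a, b) := by rw [← map_add]; simp
    have h3 := hL a
    simp only [ContinuousLinearMap.coe_coe] at h3
    simp [p, q, ← h3, this]
  let Θ₀ := (hGat _ hy0).toOpenPartialHomeomorph G hd (by simp)
  have hΘ₀ : ⇑Θ₀ = G := rfl
  have hfd : ContinuousOn (fderiv ℝ G) s := hG.continuousOn_fderiv_of_isOpen hs (by simp)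
  -- Smoothness of the inverse on the whole target needs an invertible derivative at every point of
  -- the source, not only at `L (u, 0)`; invertibility is an open condition.
  let t : Set V := s ∩ fderiv ℝ G ⁻¹' Set.range ((↑) : (V ≃L[ℝ] V) → V →L[ℝ] V)
  have ht : IsOpen t := hfd.isOpen_inter_preimage hs ContinuousLinearEquiv.isOpen
  refine ⟨L, Θ₀.restrOpen t ht, ?_, ?_, ?_, ?_⟩
  · rw [OpenPartialHomeomorph.restrOpen_source]
    refine ⟨ContDiffAt.mem_toOpenPartialHomeomorph_source _ hd _, hy0, ?_⟩
    exact ⟨_, hd.fderiv.symm⟩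
  · intro w
    change G _ = _
    simp [G, p, q]
  · exact hG.mono fun y hy => by
      rw [OpenPartialHomeomorph.restrOpen_source] at hy
      exact hy.2.1
  · intro z hz
    have hz' := (Θ₀.restrOpen t ht).map_target hz
    rw [OpenPartialHomeomorph.restrOpen_source] at hz'
    obtain ⟨-, hz1, e, he⟩ := hz'
    refine (OpenPartialHomeomorph.contDiffAt_symm (f₀' := e) _ hz ?_ ?_).contDiffWithinAt
    · rw [he]
      exact ((hGat _ hz1).differentiableAt (by simp)).hasFDerivAt
    · exact hGat _ hz1

end Straightening

/-! ### Slice charts and the embedded submanifolds they define. -/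

/-- A smooth parametrisation `par : U → V` of an open piece of the image of `ι : X → V` together
with a smooth left inverse `ret`, defined on an open set `dom` of the ambient space. -/
structure SliceChart {X : Type} {V : Type} [NormedAddCommGroup V] [NormedSpace ℝ V] (ι : X → V)
    (E : Type) [NormedAddCommGroup E] [NormedSpace ℝ E] where
  ret : V → E
  par : E → V
  dom : Set V
  U : Set E
  isOpen_dom : IsOpen dom
  isOpen_U : IsOpen U
  contDiffOn_ret : ContDiffOn ℝ ∞ ret dom
  contDiffOn_par : ContDiffOn ℝ ∞ par U
  exists_eq_par : ∀ u ∈ U, ∃ x, ι x = par u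
  par_mem : ∀ u ∈ U, par u ∈ dom
  ret_mem : ∀ x, ι x ∈ dom → ret (ι x) ∈ U
  ret_par : ∀ u ∈ U, ret (par u) = u
  par_ret : ∀ x, ι x ∈ dom → par (ret (ι x)) = ι x

namespace SliceChart

variable {X V E E' : Type} [NormedAddCommGroup V] [NormedSpace ℝ V]
  [NormedAddCommGroup E] [NormedSpace ℝ E] [NormedAddCommGroup E'] [NormedSpace ℝ E']
  {ι : X → V}

/-- Change of the model space. -/
def trans (c : SliceChart ι E) (L : E ≃L[ℝ] E') : SliceChart ι E' where
  ret := L ∘ c.ret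
  par := c.par ∘ L.symm
  dom := c.dom
  U := L.symm ⁻¹' c.U
  isOpen_dom := c.isOpen_dom
  isOpen_U := c.isOpen_U.preimage L.symm.continuous
  contDiffOn_ret := L.contDiff.comp_contDiffOn c.contDiffOn_ret
  contDiffOn_par := c.contDiffOn_par.comp L.symm.contDiff.contDiffOn fun _ h => h
  exists_eq_par u hu := c.exists_eq_par _ hu
  par_mem u hu := c.par_mem _ hu
  ret_mem x hx := by simpa using c.ret_mem x hx
  ret_par u hu := by simp [c.ret_par _ hu]
  par_ret x hx := by simpa using c.par_ret x hx

/-- Transport along an isomorphism of the ambient spaces that identifies the images. -/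
def comap {X' V' : Type} [NormedAddCommGroup V'] [NormedSpace ℝ V'] {ι' : X' → V'}
    (c : SliceChart ι E) (A : V' ≃L[ℝ] V) (h : ∀ x', ∃ x, ι x = A (ι' x'))
    (h' : ∀ x, ∃ x', A (ι' x') = ι x) : SliceChart ι' E where
  ret := c.ret ∘ A
  par := A.symm ∘ c.par
  dom := A ⁻¹' c.dom
  U := c.U
  isOpen_dom := c.isOpen_dom.preimage A.continuous
  isOpen_U := c.isOpen_U
  contDiffOn_ret := c.contDiffOn_ret.comp A.contDiff.contDiffOn fun _ h => h
  contDiffOn_par := A.symm.contDiff.comp_contDiffOn c.contDiffOn_par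
  exists_eq_par u hu := by
    obtain ⟨x, hx⟩ := c.exists_eq_par u hu
    obtain ⟨x', hx'⟩ := h' x
    exact ⟨x', by simp [← hx, ← hx']⟩
  par_mem u hu := by simpa using c.par_mem u hu
  ret_mem x' hx' := by
    obtain ⟨x, hx⟩ := h x'
    simp only [Function.comp_apply, ← hx]
    exact c.ret_mem x (by simpa [hx] using hx')
  ret_par u hu := by simpa using c.ret_par u hu
  par_ret x' hx' := by
    obtain ⟨x, hx⟩ := h x'
    simp only [Function.comp_apply, ← hx, c.par_ret x (by simpa [hx] using hx')]
    simp [hx]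

/-- By the chain rule for `ret ∘ par = id`, the derivative of `ret` is a left inverse of that of
`par`. -/
theorem fderiv_par_injective (c : SliceChart ι E) {u : E} (hu : u ∈ c.U) :
    Injective (fderiv ℝ c.par u) := by
  have h1 := ((c.contDiffOn_par.contDiffAt (c.isOpen_U.mem_nhds hu)).differentiableAt
    (by simp)).hasFDerivAt
  have h2 := ((c.contDiffOn_ret.contDiffAt (c.isOpen_dom.mem_nhds (c.par_mem u hu))).differentiableAt
    (by simp)).hasFDerivAt
  have h3 := h2.comp u h1
  have h4 : HasFDerivAt (c.ret ∘ c.par) (ContinuousLinearMap.id ℝ E) u :=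
    (hasFDerivAt_id u).congr_of_eventuallyEq <| by
      filter_upwards [c.isOpen_U.mem_nhds hu] with v hv using c.ret_par v hv
  have h5 := h3.unique h4
  intro a b hab
  have h6 : ∀ a, (fderiv ℝ c.ret (c.par u)) (fderiv ℝ c.par u a) = a := fun a =>
    congrArg (fun f : E →L[ℝ] E => f a) h5
  rw [← h6 a, hab, h6]

theorem ι_invFun_par [Nonempty X] (c : SliceChart ι E) {u : E} (hu : u ∈ c.U) :
    ι (invFun ι (c.par u)) = c.par u :=
  invFun_eq (c.exists_eq_par u hu)

variable [TopologicalSpace X] [Nonempty X]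

/-- The chart of `X` given by a slice chart. -/
noncomputable def chart (hι : IsEmbedding ι) (c : SliceChart ι E) : OpenPartialHomeomorph X E where
  toFun := c.ret ∘ ι
  -- On `U` the point `par u` lies in the range of `ι`, so `invFun` is a true preimage there.
  invFun := invFun ι ∘ c.par
  source := ι ⁻¹' c.dom
  target := c.U
  map_source' x hx := c.ret_mem x hx
  map_target' u hu := by
    simpa [c.ι_invFun_par hu] using c.par_mem u hu
  left_inv' x hx := by
    simp [c.par_ret x hx, leftInverse_invFun hι.injective x]
  right_inv' u hu := by
    simp [c.ι_invFun_par hu, c.ret_par u hu]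
  open_source := c.isOpen_dom.preimage hι.continuous
  open_target := c.isOpen_U
  continuousOn_toFun := c.contDiffOn_ret.continuousOn.comp hι.continuous.continuousOn fun _ h => h
  continuousOn_invFun := by
    rw [hι.isInducing.continuousOn_iff]
    exact c.contDiffOn_par.continuousOn.congr fun u hu => c.ι_invFun_par hu

variable {T : Type}

/-- The charted space structure given by a family of slice charts. -/
@[reducible]
noncomputable def chartedSpace (hι : IsEmbedding ι) (c : T → SliceChart ι E)
    (rep : X → T) (h : ∀ x, ι x ∈ (c (rep x)).dom) : ChartedSpace E X where
  atlas := Set.range fun t => (c t).chart hι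
  chartAt x := (c (rep x)).chart hι
  mem_chart_source x := h x
  chart_mem_atlas x := ⟨rep x, rfl⟩

/-- The points of `X` drop out of a change of charts: it is `ret` of one chart after `par` of the
other, a composition of smooth maps between vector spaces. -/
theorem isManifold (hι : IsEmbedding ι) (c : T → SliceChart ι E)
    (rep : X → T) (h : ∀ x, ι x ∈ (c (rep x)).dom) :
    letI := chartedSpace hι c rep h
    IsManifold 𝓘(ℝ, E) ∞ X := by
  let := chartedSpace hι c rep h
  refine isManifold_of_contDiffOn 𝓘(ℝ, E) ∞ X ?_
  rintro _ _ ⟨t, rfl⟩ ⟨t', rfl⟩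
  have h1 : ContDiffOn ℝ ∞ ((c t').ret ∘ (c t).par)
      ((c t).U ∩ (c t).par ⁻¹' (c t').dom) :=
    (c t').contDiffOn_ret.comp ((c t).contDiffOn_par.mono fun _ h => h.1) fun _ h => h.2
  have key : ∀ u ∈ (((c t).chart hι).symm.trans ((c t').chart hι)).source,
      u ∈ (c t).U ∧ (c t).par u ∈ (c t').dom := by
    intro u hu
    rw [OpenPartialHomeomorph.trans_source] at hu
    obtain ⟨hu, hu'⟩ := hu
    have hu : u ∈ (c t).U := hu
    change ι (invFun ι ((c t).par u)) ∈ (c t').dom at hu'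
    rw [(c t).ι_invFun_par hu] at hu'
    exact ⟨hu, hu'⟩
  refine (h1.mono (fun u hu => ?_)).congr (fun u hu => ?_)
  · exact key u hu.1
  · have := (c t).ι_invFun_par (key u hu.1).1
    change (c t').ret (ι (invFun ι ((c t).par u))) = _
    rw [this]; rfl

theorem isSmoothEmbedding [FiniteDimensional ℝ E] [FiniteDimensional ℝ V] (hι : IsEmbedding ι)
    (c : T → SliceChart ι E) (rep : X → T) (h : ∀ x, ι x ∈ (c (rep x)).dom) :
    letI := chartedSpace hι c rep h
    Manifold.IsSmoothEmbedding 𝓘(ℝ, E) 𝓘(ℝ, V) ∞ ι := by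
  let := chartedSpace hι c rep h
  have := isManifold hι c rep h
  refine ⟨?_, hι⟩
  refine Manifold.IsImmersionOfComplement.isImmersion
    (F := EuclideanSpace ℝ (Fin (finrank ℝ V - finrank ℝ E))) fun x => ?_
  let d := c (rep x)
  have hu : d.ret (ι x) ∈ d.U := d.ret_mem x (h x)
  -- The complement has dimension given by a truncated subtraction, which is the right codimension
  -- only because of this inequality.
  have hle : finrank ℝ E ≤ finrank ℝ V :=
    LinearMap.finrank_le_finrank_of_injective (f := (fderiv ℝ d.par (d.ret (ι x)) : E →ₗ[ℝ] V))
      (d.fderiv_par_injective hu)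
  obtain ⟨L, Θ, h0, hΘ, hs, hs'⟩ := exists_straightening
    (F := EuclideanSpace ℝ (Fin (finrank ℝ V - finrank ℝ E))) d.isOpen_U d.contDiffOn_par hu
    (d.fderiv_par_injective hu) (by simp; omega)
  -- The chart of `X` is shrunk to where `Θ.symm` undoes `Θ`. There `Θ.symm`, used as a chart of
  -- `V`, turns `par w = Θ (L (w, 0))` into `L (w, 0)`, the normal form of an immersion.
  let W : Set E := {w | L (w, 0) ∈ Θ.source}
  have hW : IsOpen W := Θ.open_source.preimage (by fun_prop)
  let φ := d.chart hι
  have hφW : IsOpen (φ.source ∩ φ ⁻¹' W) := φ.isOpen_inter_preimage hW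
  refine Manifold.IsImmersionAtOfComplement.mk_of_continuousAt hι.continuous.continuousAt L
    (φ.restr (φ.source ∩ φ ⁻¹' W)) Θ.symm ?_ ?_ ?_ ?_ ?_
  · rw [φ.restr_source' _ hφW]
    exact ⟨h x, h x, h0⟩
  · have := Θ.map_source h0
    rw [hΘ, d.par_ret x (h x)] at this
    exact this
  · exact restr_mem_maximalAtlas (contDiffGroupoid ∞ 𝓘(ℝ, E))
      (IsManifold.chart_mem_maximalAtlas x) hφW
  · exact OpenPartialHomeomorph.mem_maximalAtlas_of_contMDiffOn _ hs'.contMDiffOn hs.contMDiffOn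
  · intro w hw
    have hw' : w ∈ (φ.restr (φ.source ∩ φ ⁻¹' W)).target := by
      simpa using hw
    have hsrc := (φ.restr (φ.source ∩ φ ⁻¹' W)).map_target hw'
    rw [φ.restr_source' _ hφW] at hsrc
    have hwU : w ∈ φ.target := by
      rw [OpenPartialHomeomorph.restr_target] at hw'
      exact hw'.1
    have hwW : L (w, 0) ∈ Θ.source := by
      have h1 := hsrc.2.2
      have h2 : φ (φ.symm w) = w := φ.right_inv hwU
      change φ (φ.symm w) ∈ W at h1
      rwa [h2] at h1
    change Θ.symm (ι (invFun ι (d.par w))) = L (w, 0)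
    rw [d.ι_invFun_par hwU, ← hΘ w]
    exact Θ.left_inv hwW

end SliceChart

/-! ### Smooth maps out of the target of a submersion. -/

/-- A map out of the target of a surjective submersion is smooth if its composition with the
submersion is. -/
theorem Manifold.IsSubmersion.contMDiff_of_comp {E E' E'' : Type} [NormedAddCommGroup E]
    [NormedSpace ℝ E] [NormedAddCommGroup E'] [NormedSpace ℝ E'] [NormedAddCommGroup E'']
    [NormedSpace ℝ E''] {M N P : Type} [TopologicalSpace M] [ChartedSpace E M]
    [TopologicalSpace N] [ChartedSpace E' N] [TopologicalSpace P] [ChartedSpace E'' P]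
    {π : M → N} (hπ : Manifold.IsSubmersion 𝓘(ℝ, E) 𝓘(ℝ, E') ∞ π) (hsurj : Surjective π)
    {f : N → P} (hf : ContMDiff 𝓘(ℝ, E) 𝓘(ℝ, E'') ∞ (f ∘ π)) :
    ContMDiff 𝓘(ℝ, E') 𝓘(ℝ, E'') ∞ f := by
  intro y
  obtain ⟨x, rfl⟩ := hsurj y
  have h := hπ.isSubmersionAt x
  let φ := h.domChart
  let ψ := h.codChart
  let e := h.equiv
  -- Freezing the fibre coordinate at its value at `x` gives the local section `φ.symm ∘ τ ∘ ψ` of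
  -- `π`, and near `π x` the map `f` is `f ∘ π` composed with it.
  let τ : E' → E := fun v => e.symm (v, (e (φ x)).2)
  have hτ : ContDiff ℝ ∞ τ := e.symm.contDiff.comp (contDiff_id.prodMk contDiff_const)
  have hw : ∀ u ∈ φ.target, ψ (π (φ.symm u)) = (e u).1 := fun u hu =>
    h.writtenInCharts (by simpa using hu)
  have hx : x ∈ φ.source := h.mem_domChart_source
  have hy : π x ∈ ψ.source := h.mem_codChart_source
  have hτx : τ (ψ (π x)) = φ x := by
    have := hw (φ x) (φ.map_source hx)
    rw [φ.left_inv hx] at this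
    simp [τ, this]
  have hψ : ContMDiffAt 𝓘(ℝ, E') 𝓘(ℝ, E') ∞ ψ (π x) :=
    contMDiffAt_of_mem_maximalAtlas h.codChart_mem_maximalAtlas hy
  have hτψ : ContMDiffAt 𝓘(ℝ, E') 𝓘(ℝ, E) ∞ (τ ∘ ψ) (π x) :=
    hτ.contMDiff.contMDiffAt.comp _ hψ
  have hφ : ContMDiffAt 𝓘(ℝ, E) 𝓘(ℝ, E) ∞ φ.symm ((τ ∘ ψ) (π x)) := by
    refine contMDiffAt_symm_of_mem_maximalAtlas h.domChart_mem_maximalAtlas ?_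
    simp only [Function.comp_apply, hτx]
    exact φ.map_source hx
  have hσ := hφ.comp (π x) hτψ
  have hcomp := (hf (φ.symm ((τ ∘ ψ) (π x)))).comp (π x) hσ
  refine hcomp.congr_of_eventuallyEq ?_
  have h1 : ∀ᶠ y in 𝓝 (π x), y ∈ ψ.source := ψ.open_source.mem_nhds hy
  have h2 : ∀ᶠ y in 𝓝 (π x), τ (ψ y) ∈ φ.target := by
    refine hτψ.continuousAt.preimage_mem_nhds (φ.open_target.mem_nhds ?_)
    simp only [Function.comp_apply, hτx]
    exact φ.map_source hx
  filter_upwards [h1, h2] with y hy1 hy2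
  have h3 := hw _ hy2
  have h4 : π (φ.symm (τ (ψ y))) ∈ ψ.source :=
    h.source_subset_preimage_source (φ.map_target hy2)
  have h5 : π (φ.symm (τ (ψ y))) = y := ψ.injOn h4 hy1 (by rw [h3]; simp [τ])
  simp [h5]

/-! ### Linear algebra: transitivity of conjugation and the stabiliser of `R`. -/

/-- An anti-symplectic involution of a symplectic vector space has a symplectic basis
of eigenvectors. -/
theorem exists_symplectic_eigenbasis {V : Type} [AddCommGroup V] [Module ℝ V]
    [FiniteDimensional ℝ V] {n : ℕ} (hV : finrank ℝ V = n + n) (Ω : V →ₗ[ℝ] V →ₗ[ℝ] ℝ)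
    (hΩ : ∀ v, (∀ w, Ω v w = 0) → v = 0) (S : V →ₗ[ℝ] V)
    (hS : ∀ v, S (S v) = v) (hSΩ : ∀ v w, Ω (S v) (S w) = -Ω v w) :
    ∃ e f : Fin n → V, (∀ i, S (e i) = e i) ∧ (∀ i, S (f i) = -f i) ∧
      (∀ i j, Ω (e i) (f j) = if i = j then 1 else 0) ∧ (∀ i j, Ω (e i) (e j) = 0) ∧
      (∀ i j, Ω (f i) (f j) = 0) := by
  let P : Submodule ℝ V := LinearMap.ker (S - LinearMap.id)
  let M : Submodule ℝ V := LinearMap.ker (S + LinearMap.id)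
  have hP : ∀ v, v ∈ P ↔ S v = v := fun v => by simp [P, sub_eq_zero]
  have hM : ∀ v, v ∈ M ↔ S v = -v := fun v => by simp [M, add_eq_zero_iff_eq_neg]
  have hPM : ∀ v, ∃ a ∈ P, ∃ b ∈ M, v = a + b := by
    intro v
    refine ⟨(1 / 2 : ℝ) • (v + S v), (hP _).2 ?_, (1 / 2 : ℝ) • (v - S v), (hM _).2 ?_, ?_⟩
    · simp [hS, add_comm]
    · simp [hS, ← smul_neg]
    · module
  have hPP : ∀ v ∈ P, ∀ w ∈ P, Ω v w = 0 := by
    intro v hv w hw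
    have := hSΩ v w
    rw [(hP v).1 hv, (hP w).1 hw] at this
    linarith
  have hMM : ∀ v ∈ M, ∀ w ∈ M, Ω v w = 0 := by
    intro v hv w hw
    have := hSΩ v w
    rw [(hM v).1 hv, (hM w).1 hw] at this
    simp only [map_neg, LinearMap.neg_apply, neg_neg] at this
    linarith
  have hcompl : IsCompl P M := by
    refine ⟨Submodule.disjoint_def.2 fun v h1 h2 => ?_, codisjoint_iff.2 ?_⟩
    · have h3 : v = -v := ((hP v).1 h1).symm.trans ((hM v).1 h2)
      have h4 : (2 : ℝ) • v = 0 := by rw [two_smul]; exact eq_neg_iff_add_eq_zero.1 h3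
      simpa using h4
    · refine Submodule.eq_top_iff'.2 fun v => ?_
      obtain ⟨a, ha, b, hb, rfl⟩ := hPM v
      exact Submodule.add_mem_sup ha hb
  -- Isotropy of `P` and `M` and nondegeneracy make both `P → M*` and `M → P*` injective. The
  -- dimensions are therefore equal, and both are `n` as they sum to `n + n`.
  let φ : P →ₗ[ℝ] Dual ℝ M := (LinearMap.lcomp ℝ ℝ M.subtype).comp (Ω.comp P.subtype)
  let φ' : M →ₗ[ℝ] Dual ℝ P := (LinearMap.lcomp ℝ ℝ P.subtype).comp (Ω.comp M.subtype)
  have hφ : ∀ v w, φ v w = Ω v w := fun _ _ => rfl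
  have hφ' : ∀ v w, φ' v w = Ω v w := fun _ _ => rfl
  have hinj : Injective φ := by
    refine (injective_iff_map_eq_zero φ).2 fun v hv => Subtype.ext (hΩ _ fun w => ?_)
    obtain ⟨a, ha, b, hb, rfl⟩ := hPM w
    have := hφ v ⟨b, hb⟩
    rw [hv] at this
    rw [map_add, hPP _ v.2 _ ha, ← this]
    simp
  have hinj' : Injective φ' := by
    refine (injective_iff_map_eq_zero φ').2 fun v hv => Subtype.ext (hΩ _ fun w => ?_)
    obtain ⟨a, ha, b, hb, rfl⟩ := hPM w
    have := hφ' v ⟨a, ha⟩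
    rw [hv] at this
    rw [map_add, hMM _ v.2 _ hb, ← this]
    simp
  have h1 := LinearMap.finrank_le_finrank_of_injective hinj
  have h2 := LinearMap.finrank_le_finrank_of_injective hinj'
  rw [Subspace.dual_finrank_eq] at h1 h2
  have h3 := Submodule.finrank_add_eq_of_isCompl hcompl
  have hMn : finrank ℝ M = n := by omega
  let b := finBasisOfFinrankEq ℝ M hMn
  let Φ : P ≃ₗ[ℝ] Dual ℝ M := LinearMap.linearEquivOfInjective φ hinj
    (by rw [Subspace.dual_finrank_eq]; omega)
  -- The `f i` are a basis of `M`, and the `e i` are its dual basis transported to `P` by the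
  -- pairing.
  refine ⟨fun i => Φ.symm (b.coord i), fun i => b i, fun i => (hP _).1 (Subtype.prop _),
    fun i => (hM _).1 (Subtype.prop _), fun i j => ?_,
    fun i j => hPP _ (Subtype.prop _) _ (Subtype.prop _),
    fun i j => hMM _ (Subtype.prop _) _ (Subtype.prop _)⟩
  have : φ (Φ.symm (b.coord i)) = b.coord i := Φ.apply_symm_apply _
  rw [← hφ, this]
  simp [Finsupp.single_apply, eq_comm]

theorem omega_R (n : ℕ) (v w : Fin n ⊕ Fin n → ℝ) :
    omega n (R n *ᵥ v) (R n *ᵥ w) = -omega n v w := by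
  have h : ∀ v, R n *ᵥ v = Sum.elim (fun i => v (Sum.inl i)) (fun i => -v (Sum.inr i)) := by
    intro v
    ext i
    rcases i with i | i <;> simp [R, Matrix.fromBlocks_mulVec, Matrix.neg_mulVec]
  simp only [omega, h, ← Finset.sum_neg_distrib, Sum.elim_inl, Sum.elim_inr]
  exact Finset.sum_congr rfl fun i _ => by ring

theorem R_mul_R (n : ℕ) : R n * R n = 1 := by
  simp [R, Matrix.fromBlocks_multiply]

theorem R_mem_antiInv (n : ℕ) : R n ∈ AntiInv n := ⟨R_mul_R n, omega_R n⟩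

theorem R_inv (n : ℕ) : (R n)⁻¹ = R n := Matrix.inv_eq_right_inv (R_mul_R n)

/-- As `R` reverses the sign of `ω`, being anti-symplectic becomes membership of `R * S` in the
symplectic group. -/
theorem mem_antiInv_iff (n : ℕ) (S : Mat n) :
    S ∈ AntiInv n ↔ S * S = 1 ∧ R n * S ∈ Matrix.symplecticGroup (Fin n) ℝ := by
  simp [AntiInv, mem_Sp_iff, ← Matrix.mulVec_mulVec, omega_R, neg_eq_iff_eq_neg]

/-- Because `R * R = 1`, the equation `ψ = R ψ⁻¹ R` says that `R ψ` squares to the identity. -/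
theorem mem_SpR_iff (n : ℕ) (ψ : Mat n) : ψ ∈ SpR n ↔ R n * ψ ∈ AntiInv n := by
  rw [mem_antiInv_iff, ← Matrix.mul_assoc (R n) (R n) ψ, R_mul_R, Matrix.one_mul, SpR,
    Set.mem_ofPred_eq, and_comm]
  refine and_congr_left fun hψ => ?_
  have hu : IsUnit ψ.det := SymplecticGroup.symplectic_det hψ
  constructor
  · intro h
    nth_rw 1 [h]
    simp only [← Matrix.mul_assoc, R_mul_R, Matrix.one_mul]
    rw [Matrix.mul_assoc, Matrix.mul_assoc ψ⁻¹, ← Matrix.mul_assoc (R n), R_mul_R, Matrix.one_mul,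
      Matrix.nonsing_inv_mul _ hu]
  · intro h
    have h1 : ψ⁻¹ = R n * ψ * R n := by
      refine Matrix.inv_eq_left_inv ?_
      rw [Matrix.mul_assoc, h]
    rw [h1]
    simp only [← Matrix.mul_assoc, R_mul_R, Matrix.one_mul]
    rw [Matrix.mul_assoc, R_mul_R, Matrix.mul_one]

theorem sp_isUnit_det {n : ℕ} (ψ : Sp n) : IsUnit (ψ : Mat n).det :=
  SymplecticGroup.symplectic_det ψ.2

theorem conj_mem_antiInv {n : ℕ} (ψ : Sp n) {S : Mat n} (hS : S ∈ AntiInv n) :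
    (ψ : Mat n)⁻¹ * S * ψ ∈ AntiInv n := by
  have hψ := (mem_Sp_iff n _).1 ψ.2
  have hψ' := (mem_Sp_iff n _).1 (ψ⁻¹).2
  rw [SymplecticGroup.coe_inv'] at hψ'
  refine ⟨?_, fun v w => ?_⟩
  · calc (ψ : Mat n)⁻¹ * S * ψ * ((ψ : Mat n)⁻¹ * S * ψ)
        = (ψ : Mat n)⁻¹ * S * (ψ * (ψ : Mat n)⁻¹) * S * ψ := by simp only [Matrix.mul_assoc]
      _ = (ψ : Mat n)⁻¹ * (S * S) * ψ := by
        rw [Matrix.mul_nonsing_inv _ (sp_isUnit_det ψ)]; simp only [Matrix.mul_assoc, Matrix.one_mul]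
      _ = 1 := by rw [hS.1, Matrix.mul_one, Matrix.nonsing_inv_mul _ (sp_isUnit_det ψ)]
  · simp only [← Matrix.mulVec_mulVec, hψ', hS.2, hψ]

theorem conj_mem_antiInv' {n : ℕ} (ψ : Sp n) {S : Mat n} (hS : S ∈ AntiInv n) :
    (ψ : Mat n) * S * (ψ : Mat n)⁻¹ ∈ AntiInv n := by
  have h := conj_mem_antiInv ψ⁻¹ hS
  rwa [SymplecticGroup.coe_inv', Matrix.nonsing_inv_nonsing_inv _ (sp_isUnit_det ψ)] at h

/-- The matrix `φ` with the symplectic eigenbasis as columns is symplectic and satisfies `S φ = φ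
R`; its inverse is the required `ψ`. -/
theorem exists_sp_conj {n : ℕ} {S : Mat n} (hS : S ∈ AntiInv n) :
    ∃ ψ : Sp n, S = (ψ : Mat n)⁻¹ * R n * ψ := by
  have happ : ∀ v w, -Matrix.toBilin' (Matrix.J (Fin n) ℝ) v w = omega n v w := fun v w => by
    rw [Matrix.toBilin'_apply', dotProduct_J_mulVec, neg_neg]
  have hanti : ∀ v w, omega n v w = -omega n w v := fun v w => by
    simp only [omega, ← Finset.sum_neg_distrib]
    exact Finset.sum_congr rfl fun i _ => by ring
  obtain ⟨e, f, he, hf, hef, hee, hff⟩ := exists_symplectic_eigenbasis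
    (V := Fin n ⊕ Fin n → ℝ) (n := n) (by simp) (-Matrix.toBilin' (Matrix.J (Fin n) ℝ))
    (fun v hv => by
      simp only [LinearMap.neg_apply, happ] at hv
      ext i
      rcases i with i | i
      · simpa [omega, Pi.single_apply] using hv (Pi.single (Sum.inr i) 1)
      · simpa [omega, Pi.single_apply] using hv (Pi.single (Sum.inl i) 1))
    (Matrix.mulVecLin S) (fun v => by simp [hS.1])
    (fun v w => by
      simpa only [LinearMap.neg_apply, happ, Matrix.mulVecLin_apply] using hS.2 v w)
  simp only [LinearMap.neg_apply, happ, Matrix.mulVecLin_apply] at he hf hef hee hff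
  let φ : Mat n := Matrix.of fun i j => Sum.elim e f j i
  have hcol : ∀ v, φ *ᵥ v = ∑ i, v (Sum.inl i) • e i + ∑ i, v (Sum.inr i) • f i := by
    intro v
    ext k
    simp [φ, Matrix.mulVec, dotProduct, Fintype.sum_sum_type, mul_comm]
  have hφ : φ ∈ Matrix.symplecticGroup (Fin n) ℝ := by
    rw [SymplecticGroup.mem_iff']
    have hent : ∀ i j, (φᵀ * Matrix.J (Fin n) ℝ * φ) i j
        = -omega n (Sum.elim e f i) (Sum.elim e f j) := by
      intro i j
      rw [← dotProduct_J_mulVec, Matrix.mul_assoc]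
      rfl
    ext i j
    rw [hent]
    rcases i with i | i <;> rcases j with j | j
    · simp [hee, Matrix.J]
    · simp [hef, Matrix.J, Matrix.one_apply]
    · simp [hanti (f i), hef, Matrix.J, Matrix.one_apply, eq_comm]
    · simp [hff, Matrix.J]
  have hcomm : S * φ = φ * R n := by
    ext k j
    rcases j with j | j
    · have := congrFun (he j) k
      simpa [Matrix.mul_apply, Matrix.mulVec, dotProduct, φ, R, Fintype.sum_sum_type,
        Matrix.one_apply] using this
    · have := congrFun (hf j) k
      simpa [Matrix.mul_apply, Matrix.mulVec, dotProduct, φ, R, Fintype.sum_sum_type,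
        Matrix.one_apply] using this
  refine ⟨(⟨φ, hφ⟩ : Sp n)⁻¹, ?_⟩
  have hu : IsUnit φ.det := SymplecticGroup.symplectic_det hφ
  rw [SymplecticGroup.coe_inv', Matrix.nonsing_inv_nonsing_inv _ hu, ← hcomm, Matrix.mul_assoc,
    Matrix.mul_nonsing_inv _ hu, Matrix.mul_one]

theorem glHom_injective (n : ℕ) : Injective (glHom n) := by
  intro A B h
  have h1 := congrArg (fun ψ : Sp n => (ψ : Mat n).toBlocks₁₁) h
  exact Units.ext (by simpa [glHom] using h1)

/-- Commuting with `R` kills the off-diagonal blocks, and the symplectic relation `aᵀ d = 1` then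
determines `d`. -/
theorem mem_GlSub_iff (n : ℕ) (ψ : Sp n) :
    ψ ∈ GlSub n ↔ R n * (ψ : Mat n) = (ψ : Mat n) * R n := by
  constructor
  · rintro ⟨A, rfl⟩
    simp [glHom, R, Matrix.fromBlocks_multiply]
  · intro h
    obtain ⟨a, b, c, d, hψ⟩ : ∃ a b c d, (ψ : Mat n) = Matrix.fromBlocks a b c d :=
      ⟨_, _, _, _, (Matrix.fromBlocks_toBlocks _).symm⟩
    have hm := ψ.2
    rw [hψ] at h hm
    simp only [R, Matrix.fromBlocks_multiply, Matrix.fromBlocks_inj, Matrix.one_mul,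
      Matrix.zero_mul, Matrix.mul_zero, Matrix.mul_one, add_zero, zero_add, Matrix.neg_mul,
      Matrix.mul_neg, true_and, and_true] at h
    obtain ⟨hb, hc⟩ := h
    have hb : b = 0 := by
      ext i j
      have := congrFun₂ hb i j
      simp only [Matrix.neg_apply, Matrix.zero_apply] at this ⊢
      linarith
    have hc : c = 0 := by
      ext i j
      have := congrFun₂ hc i j
      simp only [Matrix.neg_apply, Matrix.zero_apply] at this ⊢
      linarith
    subst hb hc
    rw [SymplecticGroup.fromBlocks_mem_iff] at hm
    have hd : aᵀ * d = 1 := by simpa using hm.2.2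
    have ha : IsUnit a := by
      rw [Matrix.isUnit_iff_isUnit_det, ← Matrix.det_transpose]
      exact IsUnit.of_mul_eq_one d.det (by rw [← Matrix.det_mul, hd, Matrix.det_one])
    refine ⟨ha.unit, Subtype.ext ?_⟩
    rw [hψ]
    simp [glHom, Matrix.inv_eq_right_inv hd]

/-- Two symplectic matrices lie in the same coset exactly when they conjugate `R` to the same
anti-symplectic involution. -/
theorem proj_eq_iff {n : ℕ} (ψ χ : Sp n) :
    proj n ψ = proj n χ ↔
      (ψ : Mat n)⁻¹ * R n * ψ = (χ : Mat n)⁻¹ * R n * χ := by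
  have hψ := sp_isUnit_det ψ
  have hχ := sp_isUnit_det χ
  rw [proj, proj, Quotient.eq, QuotientGroup.rightRel_apply, mem_GlSub_iff,
    Submonoid.coe_mul, SymplecticGroup.coe_inv']
  constructor
  · intro h
    calc (ψ : Mat n)⁻¹ * R n * ψ
        = (χ : Mat n)⁻¹ * (χ * (ψ : Mat n)⁻¹ * R n) * ψ := by
          rw [Matrix.mul_assoc (χ : Mat n), Matrix.nonsing_inv_mul_cancel_left _ _ hχ]
      _ = (χ : Mat n)⁻¹ * R n * χ := by
          rw [← h]
          simp only [Matrix.mul_assoc, Matrix.nonsing_inv_mul _ hψ, Matrix.mul_one]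
  · intro h
    calc R n * (χ * (ψ : Mat n)⁻¹)
        = χ * ((χ : Mat n)⁻¹ * R n * χ) * (ψ : Mat n)⁻¹ := by
          simp only [Matrix.mul_assoc, Matrix.mul_nonsing_inv_cancel_left _ _ hχ]
      _ = χ * (ψ : Mat n)⁻¹ * R n := by
          rw [← h]
          simp only [Matrix.mul_assoc, Matrix.mul_nonsing_inv _ hψ, Matrix.mul_one]

/-! ### Block coordinates on `Sp(n)` and `𝒜(n)`. -/

section ExplicitFormulas

variable {n : ℕ}

/-- The symplectic matrix `diag((δᵀ)⁻¹, δ) · (1 B; 0 1) · (1 0; C 1)`. -/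
noncomputable def spOfBlocks (δ B C : Matrix (Fin n) (Fin n) ℝ) : Mat n :=
  Matrix.fromBlocks (δᵀ⁻¹ * (1 + B * C)) (δᵀ⁻¹ * B) (δ * C) δ

/-- The conjugate of `R` by `(1 B; 0 1) · (1 0; C 1)`. -/
noncomputable def antiInvOfBlocks (B C : Matrix (Fin n) (Fin n) ℝ) : Mat n :=
  Matrix.fromBlocks (1 + (2 : ℝ) • (B * C)) ((2 : ℝ) • B)
    (-((2 : ℝ) • C + (2 : ℝ) • (C * B * C))) (-(1 + (2 : ℝ) • (C * B)))

theorem spOfBlocks_mem {δ B C : Matrix (Fin n) (Fin n) ℝ} (hδ : IsUnit δ.det) (hB : Bᵀ = B)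
    (hC : Cᵀ = C) : spOfBlocks δ B C ∈ Matrix.symplecticGroup (Fin n) ℝ := by
  have hδ' : IsUnit (δᵀ).det := by rwa [Matrix.det_transpose]
  rw [spOfBlocks, SymplecticGroup.fromBlocks_mem_iff]
  simp only [Matrix.transpose_mul, Matrix.transpose_add, hB, hC,
    Matrix.transpose_nonsing_inv, Matrix.transpose_transpose, Matrix.mul_assoc,
    Matrix.nonsing_inv_mul_cancel_left _ _ hδ, Matrix.mul_nonsing_inv_cancel_left _ _ hδ',
    Matrix.nonsing_inv_mul _ hδ, Matrix.mul_nonsing_inv _ hδ', Matrix.add_mul, Matrix.mul_add,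
    Matrix.mul_one]
  simp

/-- This is the conjugation formula with the inverse cleared. The diagonal factor commutes with `R`,
so `δ` is absent from `antiInvOfBlocks`. -/
theorem R_mul_spOfBlocks (δ B C : Matrix (Fin n) (Fin n) ℝ) :
    R n * spOfBlocks δ B C = spOfBlocks δ B C * antiInvOfBlocks B C := by
  simp only [R, spOfBlocks, antiInvOfBlocks, Matrix.fromBlocks_multiply, Matrix.fromBlocks_inj,
    Matrix.one_mul, Matrix.zero_mul, add_zero, zero_add, Matrix.mul_assoc, Matrix.neg_mul,
    ← Matrix.mul_add]
  refine ⟨?_, ?_, ?_, ?_⟩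
  · congr 1
    simp only [Matrix.mul_add, Matrix.add_mul, Matrix.mul_neg, Matrix.mul_smul, Matrix.one_mul,
      Matrix.mul_one, Matrix.mul_assoc]
    module
  · congr 1
    simp only [Matrix.mul_add, Matrix.add_mul, Matrix.mul_neg, Matrix.mul_smul, Matrix.one_mul,
      Matrix.mul_one, Matrix.mul_assoc]
    module
  · rw [← Matrix.mul_neg]
    congr 1
    simp only [Matrix.mul_add, Matrix.mul_smul, Matrix.mul_one]
    module
  · simp only [Matrix.mul_add, Matrix.mul_neg, Matrix.mul_smul, Matrix.mul_one]
    module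

theorem antiInvOfBlocks_eq {δ B C : Matrix (Fin n) (Fin n) ℝ}
    (h : IsUnit (spOfBlocks δ B C).det) :
    (spOfBlocks δ B C)⁻¹ * R n * spOfBlocks δ B C = antiInvOfBlocks B C := by
  rw [Matrix.mul_assoc, R_mul_spOfBlocks, Matrix.nonsing_inv_mul_cancel_left _ _ h]

theorem antiInvOfBlocks_mem {B C : Matrix (Fin n) (Fin n) ℝ} (hB : Bᵀ = B) (hC : Cᵀ = C) :
    antiInvOfBlocks B C ∈ AntiInv n := by
  have h := spOfBlocks_mem (δ := 1) (by simp) hB hC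
  rw [← antiInvOfBlocks_eq (SymplecticGroup.symplectic_det h)]
  exact conj_mem_antiInv ⟨_, h⟩ (R_mem_antiInv n)

/-- The symplectic relations of `ψ` make `dᵀ b` symmetric, those of `ψᵀ` make `d⁻¹ c` symmetric, and
`aᵀ d - cᵀ b = 1` recovers `a` from the other blocks. -/
theorem spOfBlocks_toBlocks {ψ : Mat n} (hψ : ψ ∈ Matrix.symplecticGroup (Fin n) ℝ)
    (hd : IsUnit ψ.toBlocks₂₂.det) :
    (ψ.toBlocks₂₂ᵀ * ψ.toBlocks₁₂)ᵀ = ψ.toBlocks₂₂ᵀ * ψ.toBlocks₁₂ ∧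
    (ψ.toBlocks₂₂⁻¹ * ψ.toBlocks₂₁)ᵀ = ψ.toBlocks₂₂⁻¹ * ψ.toBlocks₂₁ ∧
    spOfBlocks ψ.toBlocks₂₂ (ψ.toBlocks₂₂ᵀ * ψ.toBlocks₁₂) (ψ.toBlocks₂₂⁻¹ * ψ.toBlocks₂₁) = ψ := by
  obtain ⟨a, b, c, d, rfl⟩ : ∃ a b c d, ψ = Matrix.fromBlocks a b c d :=
    ⟨_, _, _, _, (Matrix.fromBlocks_toBlocks _).symm⟩
  simp only [Matrix.toBlocks_fromBlocks₁₂, Matrix.toBlocks_fromBlocks₂₁,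
    Matrix.toBlocks_fromBlocks₂₂] at hd ⊢
  have hd' : IsUnit (dᵀ).det := by rwa [Matrix.det_transpose]
  have hψ' := SymplecticGroup.transpose_mem hψ
  rw [Matrix.fromBlocks_transpose, SymplecticGroup.fromBlocks_mem_iff] at hψ'
  rw [SymplecticGroup.fromBlocks_mem_iff] at hψ
  obtain ⟨-, hbd, had⟩ := hψ
  obtain ⟨-, hcd, -⟩ := hψ'
  simp only [Matrix.transpose_transpose] at hcd
  refine ⟨by simpa using hbd, ?_, ?_⟩
  · rw [Matrix.transpose_mul, Matrix.transpose_nonsing_inv]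
    calc cᵀ * dᵀ⁻¹ = d⁻¹ * (d * cᵀ) * dᵀ⁻¹ := by
          rw [Matrix.nonsing_inv_mul_cancel_left _ _ hd]
      _ = d⁻¹ * c := by
          rw [← hcd, Matrix.mul_assoc, Matrix.mul_assoc, Matrix.mul_nonsing_inv _ hd',
            Matrix.mul_one]
  · rw [spOfBlocks, Matrix.fromBlocks_inj]
    refine ⟨?_, ?_, ?_, rfl⟩
    · rw [← hbd]
      calc dᵀ⁻¹ * (1 + bᵀ * d * (d⁻¹ * c)) = dᵀ⁻¹ * (1 + bᵀ * c) := by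
            rw [Matrix.mul_assoc bᵀ, Matrix.mul_nonsing_inv_cancel_left _ _ hd]
        _ = a := by
            have h2 : 1 + bᵀ * c = dᵀ * a := by
              have h3 := congrArg Matrix.transpose had
              simp only [Matrix.transpose_sub, Matrix.transpose_mul, Matrix.transpose_transpose,
                Matrix.transpose_one] at h3
              rw [← h3]; abel
            rw [h2, Matrix.nonsing_inv_mul_cancel_left _ _ hd']
    · rw [Matrix.nonsing_inv_mul_cancel_left _ _ hd']
    · rw [Matrix.mul_nonsing_inv_cancel_left _ _ hd]

theorem spOfBlocks_toBlocks₂₂_mul {δ B C : Matrix (Fin n) (Fin n) ℝ} (hδ : IsUnit δ.det) :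
    (spOfBlocks δ B C).toBlocks₂₂ᵀ * (spOfBlocks δ B C).toBlocks₁₂ = B ∧
    (spOfBlocks δ B C).toBlocks₂₂⁻¹ * (spOfBlocks δ B C).toBlocks₂₁ = C := by
  have hδ' : IsUnit (δᵀ).det := by rwa [Matrix.det_transpose]
  simp [spOfBlocks, Matrix.mul_nonsing_inv_cancel_left _ _ hδ',
    Matrix.nonsing_inv_mul_cancel_left _ _ hδ]

/-- The relations come from computing `(R S)⁻¹` twice: as `S R`, and by the formula for the inverse
of a symplectic matrix. -/
theorem antiInv_blocks {a b c d : Matrix (Fin n) (Fin n) ℝ}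
    (hS : Matrix.fromBlocks a b c d ∈ AntiInv n) :
    d = -aᵀ ∧ bᵀ = b ∧ cᵀ = c ∧ a * a + b * c = 1 := by
  obtain ⟨h1, h2⟩ := (mem_antiInv_iff n _).1 hS
  have h3 := SymplecticGroup.inv_eq_symplectic_inv _ h2
  rw [Matrix.mul_inv_rev, R_inv, Matrix.inv_eq_right_inv h1] at h3
  simp only [R, Matrix.J, Matrix.fromBlocks_multiply, Matrix.fromBlocks_transpose,
    Matrix.fromBlocks_neg, Matrix.fromBlocks_inj, Matrix.one_mul, Matrix.zero_mul,
    Matrix.mul_zero, Matrix.mul_one, add_zero, zero_add, Matrix.neg_mul, Matrix.mul_neg, neg_zero,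
    neg_neg, Matrix.transpose_neg, neg_inj] at h3
  rw [Matrix.fromBlocks_multiply, ← Matrix.fromBlocks_one, Matrix.fromBlocks_inj] at h1
  obtain ⟨ha, hb, hc, -⟩ := h3
  refine ⟨?_, ?_, ?_, h1.1⟩
  · rw [ha]; simp
  · exact hb.symm
  · exact hc.symm

/-- The blocks of `antiInvOfBlocks B C` satisfy `b = 2B`, `a = 1 + 2BC` and `c = -C (1 + a)`;
solving for `B` and `C` gives the formulas. -/
theorem antiInvOfBlocks_toBlocks {S : Mat n} (hS : S ∈ AntiInv n)
    (hd : IsUnit (1 + S.toBlocks₁₁).det) :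
    ((1 / 2 : ℝ) • S.toBlocks₁₂)ᵀ = (1 / 2 : ℝ) • S.toBlocks₁₂ ∧
    (-(S.toBlocks₂₁ * (1 + S.toBlocks₁₁)⁻¹))ᵀ = -(S.toBlocks₂₁ * (1 + S.toBlocks₁₁)⁻¹) ∧
    antiInvOfBlocks ((1 / 2 : ℝ) • S.toBlocks₁₂) (-(S.toBlocks₂₁ * (1 + S.toBlocks₁₁)⁻¹)) = S := by
  obtain ⟨a, b, c, d, rfl⟩ : ∃ a b c d, S = Matrix.fromBlocks a b c d :=
    ⟨_, _, _, _, (Matrix.fromBlocks_toBlocks _).symm⟩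
  simp only [Matrix.toBlocks_fromBlocks₁₁, Matrix.toBlocks_fromBlocks₁₂,
    Matrix.toBlocks_fromBlocks₂₁] at hd ⊢
  obtain ⟨rfl, hb, hc, hab⟩ := antiInv_blocks hS
  have hS1 := hS.1
  rw [Matrix.fromBlocks_multiply, ← Matrix.fromBlocks_one, Matrix.fromBlocks_inj] at hS1
  obtain ⟨-, -, hca, -⟩ := hS1
  have hca : c * a = aᵀ * c := by
    rw [Matrix.neg_mul] at hca
    exact add_neg_eq_zero.1 hca
  have hd' : IsUnit (1 + aᵀ).det := by
    rwa [← Matrix.transpose_one, ← Matrix.transpose_add, Matrix.det_transpose]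
  obtain ⟨C, hC⟩ : ∃ C, C = -(c * (1 + a)⁻¹) := ⟨_, rfl⟩
  rw [← hC]
  have hCa : C * (1 + a) = -c := by
    rw [hC, Matrix.neg_mul, Matrix.mul_assoc, Matrix.nonsing_inv_mul _ hd, Matrix.mul_one]
  -- Both `C` and `Cᵀ` solve `(1 + aᵀ) X = -c`: the first by `c a = aᵀ c`, the second by transposing
  -- `hCa`.
  have hCt : Cᵀ = C := by
    have h1 : (1 + aᵀ) * C = -c := by
      rw [hC, Matrix.mul_neg, ← Matrix.mul_assoc, Matrix.add_mul, Matrix.one_mul, ← hca]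
      nth_rw 1 [← Matrix.mul_one c]
      rw [← Matrix.mul_add, Matrix.mul_assoc, Matrix.mul_nonsing_inv _ hd, Matrix.mul_one]
    have h2 : (1 + aᵀ) * Cᵀ = -c := by
      have := congrArg Matrix.transpose hCa
      rwa [Matrix.transpose_mul, Matrix.transpose_add, Matrix.transpose_one, Matrix.transpose_neg,
        hc] at this
    rw [← Matrix.nonsing_inv_mul_cancel_left (1 + aᵀ) Cᵀ hd', h2, ← h1,
      Matrix.nonsing_inv_mul_cancel_left _ _ hd']
  -- Cancel `1 + a` from `b C (1 + a) = -b c = a² - 1 = (a - 1)(1 + a)`.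
  have hbC : b * C = a - 1 := by
    have h1 : b * C * (1 + a) = (a - 1) * (1 + a) := by
      rw [Matrix.mul_assoc, hCa, Matrix.mul_neg, eq_sub_of_add_eq' hab]
      noncomm_ring
    rw [← Matrix.mul_nonsing_inv_cancel_right (1 + a) (b * C) hd, h1,
      Matrix.mul_nonsing_inv_cancel_right _ _ hd]
  have hCb : C * b = aᵀ - 1 := by
    have := congrArg Matrix.transpose hbC
    rwa [Matrix.transpose_mul, hCt, hb, Matrix.transpose_sub, Matrix.transpose_one] at this
  refine ⟨by rw [Matrix.transpose_smul, hb], hCt, ?_⟩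
  rw [antiInvOfBlocks, Matrix.fromBlocks_inj]
  refine ⟨?_, ?_, ?_, ?_⟩
  · rw [Matrix.smul_mul, hbC]
    module
  · module
  · rw [Matrix.mul_assoc, Matrix.smul_mul, hbC, ← neg_eq_iff_eq_neg.2 hCa]
    simp only [Matrix.mul_smul, Matrix.mul_add, Matrix.mul_sub, Matrix.mul_one]
    module
  · rw [Matrix.mul_smul, hCb]
    module

theorem antiInvOfBlocks_toBlocks₁₂ {B C : Matrix (Fin n) (Fin n) ℝ}
    (hd : IsUnit (1 + (antiInvOfBlocks B C).toBlocks₁₁).det) :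
    (1 / 2 : ℝ) • (antiInvOfBlocks B C).toBlocks₁₂ = B ∧
    -((antiInvOfBlocks B C).toBlocks₂₁ * (1 + (antiInvOfBlocks B C).toBlocks₁₁)⁻¹) = C := by
  simp only [antiInvOfBlocks, Matrix.toBlocks_fromBlocks₁₁, Matrix.toBlocks_fromBlocks₁₂,
    Matrix.toBlocks_fromBlocks₂₁] at hd ⊢
  refine ⟨by module, ?_⟩
  have h : -((2 : ℝ) • C + (2 : ℝ) • (C * B * C))
      = -(C * (1 + (1 + (2 : ℝ) • (B * C)))) := by
    simp only [Matrix.mul_add, Matrix.mul_smul, Matrix.mul_one, Matrix.mul_assoc]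
    module
  rw [h, Matrix.neg_mul, neg_neg, Matrix.mul_nonsing_inv_cancel_right _ _ hd]

end ExplicitFormulas

/-! ### Entrywise smoothness of matrix operations. -/

section MatrixSmoothness

variable {E : Type} [NormedAddCommGroup E] [NormedSpace ℝ E] {k l m : Type} {s : Set E}

/-- Smoothness of a matrix-valued function, entry by entry. -/
def MatContDiffOn (f : E → Matrix k l ℝ) (s : Set E) : Prop :=
  ∀ i j, ContDiffOn ℝ ∞ (fun x => f x i j) s

theorem matContDiffOn_const (M : Matrix k l ℝ) : MatContDiffOn (fun _ : E => M) s :=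
  fun _ _ => contDiffOn_const

namespace MatContDiffOn

theorem mul [Fintype l] {f : E → Matrix k l ℝ} {g : E → Matrix l m ℝ} (hf : MatContDiffOn f s)
    (hg : MatContDiffOn g s) : MatContDiffOn (fun x => f x * g x) s := fun i j => by
  simp only [Matrix.mul_apply]
  exact ContDiffOn.sum fun a _ => (hf i a).mul (hg a j)

theorem add {f g : E → Matrix k l ℝ} (hf : MatContDiffOn f s)
    (hg : MatContDiffOn g s) : MatContDiffOn (fun x => f x + g x) s := fun i j =>
  (hf i j).add (hg i j)

theorem neg {f : E → Matrix k l ℝ} (hf : MatContDiffOn f s) :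
    MatContDiffOn (fun x => -f x) s := fun i j => (hf i j).neg

theorem smul (c : ℝ) {f : E → Matrix k l ℝ} (hf : MatContDiffOn f s) :
    MatContDiffOn (fun x => c • f x) s := fun i j => contDiffOn_const.mul (hf i j)

theorem transpose {f : E → Matrix k l ℝ} (hf : MatContDiffOn f s) :
    MatContDiffOn (fun x => (f x)ᵀ) s := fun i j => hf j i

theorem det [Fintype k] [DecidableEq k] {f : E → Matrix k k ℝ} (hf : MatContDiffOn f s) :
    ContDiffOn ℝ ∞ (fun x => (f x).det) s := by
  simp only [Matrix.det_apply']
  exact ContDiffOn.sum fun σ _ => contDiffOn_const.mul (contDiffOn_prod fun i _ => hf _ _)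

/-- By Cramer's rule, the entries of the inverse are determinants divided by a nonvanishing
determinant. -/
theorem inv [Fintype k] [DecidableEq k] {f : E → Matrix k k ℝ} (hf : MatContDiffOn f s)
    (h : ∀ x ∈ s, (f x).det ≠ 0) : MatContDiffOn (fun x => (f x)⁻¹) s := fun i j => by
  simp only [Matrix.inv_def, Matrix.smul_apply, Ring.inverse_eq_inv', smul_eq_mul,
    Matrix.adjugate_apply]
  refine (hf.det.inv h).mul (MatContDiffOn.det fun a b => ?_)
  by_cases hab : a = j
  · subst hab
    simpa using contDiffOn_const
  · simpa [Matrix.updateRow_ne hab] using hf a b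

theorem fromBlocks {k' l' : Type} {a : E → Matrix k l ℝ}
    {b : E → Matrix k l' ℝ} {c : E → Matrix k' l ℝ} {d : E → Matrix k' l' ℝ}
    (ha : MatContDiffOn a s) (hb : MatContDiffOn b s) (hc : MatContDiffOn c s)
    (hd : MatContDiffOn d s) :
    MatContDiffOn (fun x => Matrix.fromBlocks (a x) (b x) (c x) (d x)) s := by
  rintro (i | i) (j | j)
  · exact ha i j
  · exact hb i j
  · exact hc i j
  · exact hd i j

theorem contDiffOn_symm [Fintype k] [Fintype l] {f : E → Matrix k l ℝ} (hf : MatContDiffOn f s) :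
    ContDiffOn ℝ ∞ (fun x => Matrix.of.symm (f x)) s :=
  contDiffOn_pi.2 fun i => contDiffOn_pi.2 fun j => hf i j

end MatContDiffOn

end MatrixSmoothness

/-- Symmetric `n × n` arrays. -/
def SymMat (n : ℕ) : Submodule ℝ (Fin n → Fin n → ℝ) where
  carrier := {B | ∀ i j, B i j = B j i}
  add_mem' ha hb i j := by simp [ha i j, hb i j]
  zero_mem' _ _ := rfl
  smul_mem' c B hB i j := by simp [hB i j]

/-- The symmetrisation of a square array. -/
noncomputable def symPart (n : ℕ) : (Fin n → Fin n → ℝ) →L[ℝ] SymMat n :=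
  LinearMap.toContinuousLinearMap
    { toFun B := ⟨fun i j => (B i j + B j i) / 2, fun i j => by simp only [add_comm]⟩
      map_add' B C := by
        ext i j
        simp only [Pi.add_apply, Submodule.coe_add]
        ring
      map_smul' c B := by
        ext i j
        simp only [Pi.smul_apply, Submodule.coe_smul, smul_eq_mul, RingHom.id_apply]
        ring }

theorem symPart_of_symm {n : ℕ} {B : Matrix (Fin n) (Fin n) ℝ} (hB : Bᵀ = B) :
    Matrix.of (symPart n (Matrix.of.symm B) : Fin n → Fin n → ℝ) = B := by
  ext i j
  have : B j i = B i j := congrFun₂ hB i j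
  simp [symPart, this]

theorem symPart_coe {n : ℕ} (B : SymMat n) : symPart n B = B := by
  ext i j
  have := B.2 i j
  simp [symPart, ← this]

theorem symMat_transpose {n : ℕ} (B : SymMat n) :
    (Matrix.of (B : Fin n → Fin n → ℝ))ᵀ = Matrix.of (B : Fin n → Fin n → ℝ) := by
  ext i j
  exact B.2 j i

/-! ### Slice charts of `𝒜(n)` and `Sp(n)`, at the base points and by translation. -/

section Charts

variable {n : ℕ}

theorem isEmbedding_entries (n : ℕ) : IsEmbedding (entries n) :=
  Homeomorph.isEmbedding (X := Mat n) (Y := Entries n) ⟨Matrix.of.symm, by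
    exact continuous_pi fun i => continuous_pi fun j => continuous_id.matrix_elem i j, by
    exact continuous_matrix fun i j => (continuous_apply j).comp (continuous_apply i)⟩

theorem matContDiffOn_of (s : Set (Entries n)) :
    MatContDiffOn (fun v : Entries n => (Matrix.of v : Mat n)) s := fun i j =>
  (contDiff_apply_apply ℝ ℝ i j).contDiffOn

theorem matContDiffOn_toBlocks {f : Entries n → Mat n} {s : Set (Entries n)}
    (hf : MatContDiffOn f s) :
    MatContDiffOn (fun v => (f v).toBlocks₁₁) s ∧ MatContDiffOn (fun v => (f v).toBlocks₁₂) s ∧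
    MatContDiffOn (fun v => (f v).toBlocks₂₁) s ∧ MatContDiffOn (fun v => (f v).toBlocks₂₂) s :=
  ⟨fun _ _ => hf _ _, fun _ _ => hf _ _, fun _ _ => hf _ _, fun _ _ => hf _ _⟩

theorem MatContDiffOn.isOpen_det_ne_zero {E : Type} [NormedAddCommGroup E] [NormedSpace ℝ E]
    {f : E → Matrix (Fin n) (Fin n) ℝ} (hf : MatContDiffOn f Set.univ) :
    IsOpen {x | (f x).det ≠ 0} :=
  isOpen_ne_fun (continuousOn_univ.1 hf.det.continuousOn) continuous_const

theorem matContDiffOn_fst {F : Type} [NormedAddCommGroup F] [NormedSpace ℝ F]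
    (s : Set ((Fin n → Fin n → ℝ) × F)) :
    MatContDiffOn (fun u => (Matrix.of u.1 : Matrix (Fin n) (Fin n) ℝ)) s := fun i j =>
  ((contDiff_apply_apply ℝ ℝ i j).comp contDiff_fst).contDiffOn

theorem matContDiffOn_coe {E : Type} [NormedAddCommGroup E] [NormedSpace ℝ E]
    (L : E →L[ℝ] SymMat n) (s : Set E) :
    MatContDiffOn (fun u => (Matrix.of (L u : Fin n → Fin n → ℝ) : Matrix (Fin n) (Fin n) ℝ)) s :=
  fun i j => ((contDiff_apply_apply ℝ ℝ i j).comp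
    (((SymMat n).subtypeL.comp L).contDiff)).contDiffOn

/-- With `X = B C` this matches the condition `det (1 + S₁₁) ≠ 0` on matrices with the condition
`det (1 + B C) ≠ 0` on coordinates. -/
theorem det_one_add_one_add_two_smul (X : Matrix (Fin n) (Fin n) ℝ) :
    (1 + (1 + (2 : ℝ) • X)).det = 2 ^ n * (1 + X).det := by
  have : 1 + (1 + (2 : ℝ) • X) = (2 : ℝ) • (1 + X) := by module
  rw [this, Matrix.det_smul, Fintype.card_fin]

/-- The model space of the charts of `𝒜(n)`. -/
abbrev AntiModel (n : ℕ) : Type := SymMat n × SymMat n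

/-- The model space of the charts of `Sp(n)`. -/
abbrev SpModel (n : ℕ) : Type := (Fin n → Fin n → ℝ) × AntiModel n

/-- `antiInvOfBlocks` on the model space. -/
noncomputable def antiPar (n : ℕ) (u : AntiModel n) : Entries n :=
  Matrix.of.symm (antiInvOfBlocks (Matrix.of (u.1 : Fin n → Fin n → ℝ))
    (Matrix.of (u.2 : Fin n → Fin n → ℝ)))

/-- `spOfBlocks` on the model space. -/
noncomputable def spPar (n : ℕ) (u : SpModel n) : Entries n :=
  Matrix.of.symm (spOfBlocks (Matrix.of u.1) (Matrix.of (u.2.1 : Fin n → Fin n → ℝ))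
    (Matrix.of (u.2.2 : Fin n → Fin n → ℝ)))

/-- The slice chart of `𝒜(n)` around `R`. -/
noncomputable def antiChartOne (n : ℕ) :
    SliceChart (fun S : AntiInv n => entries n (S : Mat n)) (AntiModel n) where
  -- Off `𝒜(n)` these blocks need not be symmetric. Symmetrising extends the coordinates to ambient
  -- matrices and changes nothing on `𝒜(n)`.
  ret v := (symPart n (Matrix.of.symm ((1 / 2 : ℝ) • (Matrix.of v : Mat n).toBlocks₁₂)),
    symPart n (Matrix.of.symm
      (-((Matrix.of v : Mat n).toBlocks₂₁ * (1 + (Matrix.of v : Mat n).toBlocks₁₁)⁻¹))))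
  par := antiPar n
  dom := {v | (1 + (Matrix.of v : Mat n).toBlocks₁₁).det ≠ 0}
  U := {u | (1 + Matrix.of (u.1 : Fin n → Fin n → ℝ) * Matrix.of (u.2 : Fin n → Fin n → ℝ)).det ≠ 0}
  isOpen_dom := ((matContDiffOn_const 1).add
    (matContDiffOn_toBlocks (matContDiffOn_of _)).1).isOpen_det_ne_zero
  isOpen_U := ((matContDiffOn_const 1).add
    ((matContDiffOn_coe (.fst ℝ (SymMat n) (SymMat n)) _).mul
      (matContDiffOn_coe (.snd ℝ (SymMat n) (SymMat n)) _))).isOpen_det_ne_zero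
  contDiffOn_ret := by
    obtain ⟨h11, h12, h21, -⟩ := matContDiffOn_toBlocks (matContDiffOn_of (n := n)
      {v | (1 + (Matrix.of v : Mat n).toBlocks₁₁).det ≠ 0})
    exact ((symPart n).contDiff.comp_contDiffOn (h12.smul _).contDiffOn_symm).prodMk
      ((symPart n).contDiff.comp_contDiffOn
        (h21.mul (((matContDiffOn_const 1).add h11).inv fun _ h => h)).neg.contDiffOn_symm)
  contDiffOn_par := by
    have h1 := matContDiffOn_coe (.fst ℝ (SymMat n) (SymMat n)) {u | (1 +
      Matrix.of (u.1 : Fin n → Fin n → ℝ) * Matrix.of (u.2 : Fin n → Fin n → ℝ)).det ≠ 0}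
    have h2 := matContDiffOn_coe (.snd ℝ (SymMat n) (SymMat n)) {u | (1 +
      Matrix.of (u.1 : Fin n → Fin n → ℝ) * Matrix.of (u.2 : Fin n → Fin n → ℝ)).det ≠ 0}
    exact (((matContDiffOn_const 1).add ((h1.mul h2).smul 2)).fromBlocks (h1.smul 2)
      ((h2.smul 2).add (((h2.mul h1).mul h2).smul 2)).neg
      ((matContDiffOn_const 1).add ((h2.mul h1).smul 2)).neg).contDiffOn_symm
  exists_eq_par u _ :=
    ⟨⟨_, antiInvOfBlocks_mem (symMat_transpose u.1) (symMat_transpose u.2)⟩, rfl⟩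
  par_mem u hu := by
    change (1 + (1 + (2 : ℝ) • (_ : Matrix (Fin n) (Fin n) ℝ))).det ≠ 0
    rw [det_one_add_one_add_two_smul]
    exact mul_ne_zero (by positivity) hu
  ret_mem S hS := by
    obtain ⟨h1, h2, h3⟩ := antiInvOfBlocks_toBlocks (S := Matrix.of (entries n (S : Mat n))) S.2 (isUnit_iff_ne_zero.2 hS)
    change (1 + Matrix.of (symPart n (Matrix.of.symm _) : Fin n → Fin n → ℝ)
      * Matrix.of (symPart n (Matrix.of.symm _) : Fin n → Fin n → ℝ)).det ≠ 0
    rw [symPart_of_symm h1, symPart_of_symm h2]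
    have h4 : (1 + (Matrix.of (entries n (S : Mat n)) : Mat n).toBlocks₁₁).det ≠ 0 := hS
    rw [← h3, antiInvOfBlocks, Matrix.toBlocks_fromBlocks₁₁, det_one_add_one_add_two_smul] at h4
    exact right_ne_zero_of_mul h4
  ret_par u hu := by
    have hu' : IsUnit (1 + (antiInvOfBlocks (Matrix.of (u.1 : Fin n → Fin n → ℝ))
        (Matrix.of (u.2 : Fin n → Fin n → ℝ))).toBlocks₁₁).det := by
      rw [isUnit_iff_ne_zero, antiInvOfBlocks, Matrix.toBlocks_fromBlocks₁₁,
        det_one_add_one_add_two_smul]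
      exact mul_ne_zero (by positivity) hu
    obtain ⟨h1, h2⟩ := antiInvOfBlocks_toBlocks₁₂ hu'
    refine Prod.ext ?_ ?_
    · refine Eq.trans ?_ (symPart_coe u.1)
      exact congrArg (fun M => symPart n (Matrix.of.symm M)) h1
    · refine Eq.trans ?_ (symPart_coe u.2)
      exact congrArg (fun M => symPart n (Matrix.of.symm M)) h2
  par_ret S hS := by
    obtain ⟨h1, h2, h3⟩ := antiInvOfBlocks_toBlocks (S := Matrix.of (entries n (S : Mat n))) S.2 (isUnit_iff_ne_zero.2 hS)
    change Matrix.of.symm (antiInvOfBlocks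
      (Matrix.of (symPart n (Matrix.of.symm _) : Fin n → Fin n → ℝ))
      (Matrix.of (symPart n (Matrix.of.symm _) : Fin n → Fin n → ℝ))) = _
    rw [symPart_of_symm h1, symPart_of_symm h2]
    exact congrArg Matrix.of.symm h3

theorem det_transpose_inv_mul_ne_zero {δ X : Matrix (Fin n) (Fin n) ℝ} (hδ : δ.det ≠ 0) :
    (δᵀ⁻¹ * X).det ≠ 0 ↔ X.det ≠ 0 := by
  rw [Matrix.det_mul, Matrix.det_nonsing_inv, Matrix.det_transpose, Ring.inverse_eq_inv',
    mul_ne_zero_iff, and_iff_right (inv_ne_zero hδ)]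

/-- The slice chart of `Sp(n)` around the identity. -/
noncomputable def spChartOne (n : ℕ) :
    SliceChart (fun ψ : Sp n => entries n (ψ : Mat n)) (SpModel n) where
  ret v := (Matrix.of.symm (Matrix.of v : Mat n).toBlocks₂₂,
    symPart n (Matrix.of.symm ((Matrix.of v : Mat n).toBlocks₂₂ᵀ * (Matrix.of v : Mat n).toBlocks₁₂)),
    symPart n (Matrix.of.symm
      ((Matrix.of v : Mat n).toBlocks₂₂⁻¹ * (Matrix.of v : Mat n).toBlocks₂₁)))
  par := spPar n
  -- The upper left block is `(δᵀ)⁻¹ (1 + B C)`. Requiring it to be invertible puts `(B, C)` in the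
  -- range of the chart of `𝒜(n)`.
  dom := {v | (Matrix.of v : Mat n).toBlocks₂₂.det ≠ 0} ∩
    {v | (Matrix.of v : Mat n).toBlocks₁₁.det ≠ 0}
  U := {u | (Matrix.of u.1).det ≠ 0} ∩ {u | (1 +
    Matrix.of (u.2.1 : Fin n → Fin n → ℝ) * Matrix.of (u.2.2 : Fin n → Fin n → ℝ)).det ≠ 0}
  isOpen_dom := (matContDiffOn_toBlocks (matContDiffOn_of _)).2.2.2.isOpen_det_ne_zero.inter
    (matContDiffOn_toBlocks (matContDiffOn_of _)).1.isOpen_det_ne_zero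
  isOpen_U := (matContDiffOn_fst _).isOpen_det_ne_zero.inter
    (((matContDiffOn_const 1).add ((matContDiffOn_coe (.fst ℝ (SymMat n) (SymMat n)) _).mul
      (matContDiffOn_coe (.snd ℝ (SymMat n) (SymMat n)) _))).isOpen_det_ne_zero.preimage
        (continuous_snd (X := Fin n → Fin n → ℝ)))
  contDiffOn_ret := by
    obtain ⟨-, h12, h21, h22⟩ := matContDiffOn_toBlocks (matContDiffOn_of (n := n)
      ({v | (Matrix.of v : Mat n).toBlocks₂₂.det ≠ 0} ∩
        {v | (Matrix.of v : Mat n).toBlocks₁₁.det ≠ 0}))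
    exact h22.contDiffOn_symm.prodMk
      (((symPart n).contDiff.comp_contDiffOn (h22.transpose.mul h12).contDiffOn_symm).prodMk
      ((symPart n).contDiff.comp_contDiffOn
        ((h22.inv fun _ h => h.1).mul h21).contDiffOn_symm))
  contDiffOn_par := by
    have h0 := matContDiffOn_fst ({u : SpModel n | (Matrix.of u.1).det ≠ 0} ∩ {u | (1 +
      Matrix.of (u.2.1 : Fin n → Fin n → ℝ) * Matrix.of (u.2.2 : Fin n → Fin n → ℝ)).det ≠ 0})
    have h1 := matContDiffOn_coe ((ContinuousLinearMap.fst ℝ (SymMat n) (SymMat n)).comp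
      (.snd ℝ (Fin n → Fin n → ℝ) _)) ({u : SpModel n | (Matrix.of u.1).det ≠ 0} ∩ {u | (1 +
      Matrix.of (u.2.1 : Fin n → Fin n → ℝ) * Matrix.of (u.2.2 : Fin n → Fin n → ℝ)).det ≠ 0})
    have h2 := matContDiffOn_coe ((ContinuousLinearMap.snd ℝ (SymMat n) (SymMat n)).comp
      (.snd ℝ (Fin n → Fin n → ℝ) _)) ({u : SpModel n | (Matrix.of u.1).det ≠ 0} ∩ {u | (1 +
      Matrix.of (u.2.1 : Fin n → Fin n → ℝ) * Matrix.of (u.2.2 : Fin n → Fin n → ℝ)).det ≠ 0})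
    have h3 := h0.transpose.inv fun u hu => by
      rw [Matrix.det_transpose]
      exact hu.1
    exact ((h3.mul ((matContDiffOn_const 1).add (h1.mul h2))).fromBlocks (h3.mul h1)
      (h0.mul h2) h0).contDiffOn_symm
  exists_eq_par u hu := ⟨⟨_, spOfBlocks_mem (isUnit_iff_ne_zero.2 hu.1) (symMat_transpose u.2.1)
    (symMat_transpose u.2.2)⟩, rfl⟩
  par_mem u hu := by
    refine ⟨hu.1, ?_⟩
    exact (det_transpose_inv_mul_ne_zero hu.1).2 hu.2
  ret_mem ψ hψ := by
    obtain ⟨h1, h2, h3⟩ := spOfBlocks_toBlocks (ψ := Matrix.of (entries n (ψ : Mat n))) ψ.2 (isUnit_iff_ne_zero.2 hψ.1)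
    refine ⟨hψ.1, ?_⟩
    change (1 + Matrix.of (symPart n (Matrix.of.symm _) : Fin n → Fin n → ℝ)
      * Matrix.of (symPart n (Matrix.of.symm _) : Fin n → Fin n → ℝ)).det ≠ 0
    rw [symPart_of_symm h1, symPart_of_symm h2]
    have h4 : (Matrix.of (entries n (ψ : Mat n)) : Mat n).toBlocks₁₁.det ≠ 0 := hψ.2
    rw [← h3, spOfBlocks, Matrix.toBlocks_fromBlocks₁₁] at h4
    exact (det_transpose_inv_mul_ne_zero hψ.1).1 h4
  ret_par u hu := by
    obtain ⟨h1, h2⟩ := spOfBlocks_toBlocks₂₂_mul (δ := Matrix.of u.1)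
      (B := Matrix.of (u.2.1 : Fin n → Fin n → ℝ)) (C := Matrix.of (u.2.2 : Fin n → Fin n → ℝ))
      (isUnit_iff_ne_zero.2 hu.1)
    refine Prod.ext rfl (Prod.ext ?_ ?_)
    · refine Eq.trans ?_ (symPart_coe u.2.1)
      exact congrArg (fun M => symPart n (Matrix.of.symm M)) h1
    · refine Eq.trans ?_ (symPart_coe u.2.2)
      exact congrArg (fun M => symPart n (Matrix.of.symm M)) h2
  par_ret ψ hψ := by
    obtain ⟨h1, h2, h3⟩ := spOfBlocks_toBlocks (ψ := Matrix.of (entries n (ψ : Mat n))) ψ.2 (isUnit_iff_ne_zero.2 hψ.1)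
    change Matrix.of.symm (spOfBlocks _
      (Matrix.of (symPart n (Matrix.of.symm _) : Fin n → Fin n → ℝ))
      (Matrix.of (symPart n (Matrix.of.symm _) : Fin n → Fin n → ℝ))) = _
    rw [symPart_of_symm h1, symPart_of_symm h2]
    exact congrArg Matrix.of.symm h3

/-- The automorphism `v ↦ P v Q` of the space of matrices. -/
noncomputable def mulMul (P Q : (Mat n)ˣ) : Entries n ≃L[ℝ] Entries n :=
  LinearEquiv.toContinuousLinearEquiv
    { toFun v := Matrix.of.symm ((P : Mat n) * Matrix.of v * Q)
      invFun v := Matrix.of.symm (((P⁻¹ : (Mat n)ˣ) : Mat n) * Matrix.of v * ((Q⁻¹ : (Mat n)ˣ) : Mat n))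
      map_add' v w := congrArg Matrix.of.symm
        (show (P : Mat n) * (Matrix.of v + Matrix.of w) * Q = _ by
          rw [Matrix.mul_add, Matrix.add_mul]; rfl)
      map_smul' c v := congrArg Matrix.of.symm
        (show (P : Mat n) * (c • Matrix.of v) * Q = _ by
          rw [Matrix.mul_smul, Matrix.smul_mul]; rfl)
      left_inv v := by
        simp only [Equiv.apply_symm_apply, Matrix.mul_assoc, Units.inv_mul_cancel_left,
          Units.mul_inv, Matrix.mul_one, Equiv.symm_apply_apply]
      right_inv v := by
        simp only [Equiv.apply_symm_apply, Matrix.mul_assoc, Units.mul_inv_cancel_left,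
          Units.inv_mul, Matrix.mul_one, Equiv.symm_apply_apply] }

theorem mulMul_entries (P Q : (Mat n)ˣ) (M : Mat n) :
    mulMul P Q (entries n M) = entries n (P * M * Q) := rfl

/-- A symplectic matrix as an invertible matrix. -/
noncomputable def spUnit (ψ : Sp n) : (Mat n)ˣ where
  val := ψ
  inv := (ψ : Mat n)⁻¹
  val_inv := Matrix.mul_nonsing_inv _ (sp_isUnit_det ψ)
  inv_val := Matrix.nonsing_inv_mul _ (sp_isUnit_det ψ)

/-- The slice chart of `Sp(n)` around `χ`. -/
noncomputable def spChart (χ : Sp n) :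
    SliceChart (fun ψ : Sp n => entries n (ψ : Mat n)) (SpModel n) :=
  (spChartOne n).comap (mulMul 1 (spUnit χ)⁻¹)
    (fun ψ => ⟨ψ * χ⁻¹, by simp [mulMul_entries, spUnit, SymplecticGroup.coe_inv']⟩)
    (fun ψ => ⟨ψ * χ, by
      simp [mulMul_entries, spUnit, Matrix.mul_assoc, Matrix.mul_nonsing_inv _ (sp_isUnit_det χ)]⟩)

/-- The slice chart of `𝒜(n)` around `χ⁻¹ R χ`. -/
noncomputable def antiChart (χ : Sp n) :
    SliceChart (fun S : AntiInv n => entries n (S : Mat n)) (AntiModel n) :=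
  -- Conjugation by `χ` carries `χ⁻¹ R χ` to `R`. It matches right translation by `χ⁻¹` on `Sp(n)`,
  -- so the two charts labelled `χ` remain compatible with `ψ ↦ ψ⁻¹ R ψ`.
  (antiChartOne n).comap (mulMul (spUnit χ) (spUnit χ)⁻¹)
    (fun S => ⟨⟨_, conj_mem_antiInv' χ S.2⟩, rfl⟩)
    (fun S => ⟨⟨_, conj_mem_antiInv χ S.2⟩, by
      have := sp_isUnit_det χ
      simp [mulMul_entries, spUnit, Matrix.mul_assoc, Matrix.mul_nonsing_inv _ this,
        Matrix.mul_nonsing_inv_cancel_left _ _ this]⟩)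

theorem mem_spChart_dom (χ : Sp n) : entries n (χ : Mat n) ∈ (spChart χ).dom := by
  have h : mulMul 1 (spUnit χ)⁻¹ (entries n (χ : Mat n)) = Matrix.of.symm 1 := by
    rw [mulMul_entries, Units.val_one, Matrix.one_mul]
    exact congrArg Matrix.of.symm (spUnit χ).mul_inv
  change mulMul 1 (spUnit χ)⁻¹ (entries n (χ : Mat n)) ∈ (spChartOne n).dom
  rw [h]
  simp [spChartOne, ← Matrix.fromBlocks_one]

theorem mem_antiChart_dom (χ : Sp n) :
    entries n ((χ : Mat n)⁻¹ * R n * χ) ∈ (antiChart χ).dom := by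
  have hu := sp_isUnit_det χ
  have h0 : (χ : Mat n) * ((χ : Mat n)⁻¹ * R n * χ) * (χ : Mat n)⁻¹ = R n := by
    simp only [Matrix.mul_assoc, Matrix.mul_nonsing_inv _ hu, Matrix.mul_one,
      Matrix.mul_nonsing_inv_cancel_left _ _ hu]
  have h : mulMul (spUnit χ) (spUnit χ)⁻¹ (entries n ((χ : Mat n)⁻¹ * R n * χ))
      = Matrix.of.symm (R n) := congrArg (entries n) h0
  change mulMul (spUnit χ) (spUnit χ)⁻¹ (entries n ((χ : Mat n)⁻¹ * R n * χ)) ∈ (antiChartOne n).dom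
  rw [h]
  have h2 : (1 + 1 : Matrix (Fin n) (Fin n) ℝ) = (2 : ℝ) • 1 := by module
  simp [antiChartOne, R, h2]

end Charts

/-! ### The coset space, identified with `𝒜(n)` through local sections. -/

section Quotient

variable {n : ℕ}

instance : Nonempty (AntiInv n) := ⟨⟨R n, R_mem_antiInv n⟩⟩

instance : Nonempty (SpR n) :=
  ⟨⟨1, (mem_SpR_iff n 1).2 (by rw [Matrix.mul_one]; exact R_mem_antiInv n)⟩⟩

instance : Nonempty (HomSpace n) := ⟨proj n 1⟩

theorem isEmbedding_sp (n : ℕ) : IsEmbedding fun ψ : Sp n => entries n (ψ : Mat n) :=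
  (isEmbedding_entries n).comp IsEmbedding.subtypeVal

theorem isEmbedding_antiInv (n : ℕ) : IsEmbedding fun S : AntiInv n => entries n (S : Mat n) :=
  (isEmbedding_entries n).comp IsEmbedding.subtypeVal

theorem isEmbedding_spR (n : ℕ) : IsEmbedding fun ψ : SpR n => entries n (ψ : Mat n) :=
  (isEmbedding_entries n).comp IsEmbedding.subtypeVal

/-- The map `ψ ↦ ψ⁻¹ R ψ` from `Sp(n)` to `𝒜(n)`. -/
noncomputable def conjR (ψ : Sp n) : AntiInv n :=
  ⟨(ψ : Mat n)⁻¹ * R n * ψ, conj_mem_antiInv ψ (R_mem_antiInv n)⟩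

/-- The polynomial map that extends `ψ ↦ ψ⁻¹ R ψ` to all matrices. -/
noncomputable def conjRPoly (n : ℕ) (v : Entries n) : Entries n :=
  Matrix.of.symm (-Matrix.J (Fin n) ℝ * (Matrix.of v : Mat n)ᵀ * Matrix.J (Fin n) ℝ * R n *
    Matrix.of v)

theorem contDiff_conjRPoly (n : ℕ) : ContDiff ℝ ∞ (conjRPoly n) := by
  rw [← contDiffOn_univ]
  have h := matContDiffOn_of (n := n) Set.univ
  exact (((((matContDiffOn_const _).mul h.transpose).mul (matContDiffOn_const _)).mul
    (matContDiffOn_const _)).mul h).contDiffOn_symm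

/-- On symplectic matrices the inverse is `-J ψᵀ J`, a linear expression in the entries. -/
theorem entries_conjR (ψ : Sp n) :
    entries n (conjR ψ : Mat n) = conjRPoly n (entries n (ψ : Mat n)) := by
  have h : (conjR ψ : Mat n) = -Matrix.J (Fin n) ℝ * (ψ : Mat n)ᵀ * Matrix.J (Fin n) ℝ * R n * ψ := by
    rw [← SymplecticGroup.inv_eq_symplectic_inv _ ψ.2]
    rfl
  rw [h]
  rfl

theorem continuous_conjR (n : ℕ) : Continuous (conjR (n := n)) := by
  rw [(isEmbedding_antiInv n).continuous_iff]
  exact ((contDiff_conjRPoly n).continuous.comp (isEmbedding_sp n).continuous).congr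
    fun ψ => (entries_conjR ψ).symm

/-- In the slice charts, the map `ψ ↦ ψ⁻¹ R ψ` is a projection. -/
theorem entries_conjR_of_eq_par {χ ψ : Sp n} {u : SpModel n} (hu : u ∈ (spChart χ).U)
    (hψ : entries n (ψ : Mat n) = (spChart χ).par u) :
    entries n (conjR ψ : Mat n) = (antiChart χ).par u.2 := by
  have hm := spOfBlocks_mem (isUnit_iff_ne_zero.2 hu.1) (symMat_transpose u.2.1)
    (symMat_transpose u.2.2)
  have h1 : (ψ : Mat n) = spOfBlocks (Matrix.of u.1) (Matrix.of (u.2.1 : Fin n → Fin n → ℝ))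
      (Matrix.of (u.2.2 : Fin n → Fin n → ℝ)) * χ := by
    have h2 : entries n (ψ : Mat n) = entries n (1 * spOfBlocks (Matrix.of u.1)
      (Matrix.of (u.2.1 : Fin n → Fin n → ℝ)) (Matrix.of (u.2.2 : Fin n → Fin n → ℝ)) * χ) := hψ
    rw [Matrix.one_mul] at h2
    exact (isEmbedding_entries n).injective h2
  have h3 : (conjR ψ : Mat n) = (χ : Mat n)⁻¹ * antiInvOfBlocks
      (Matrix.of (u.2.1 : Fin n → Fin n → ℝ)) (Matrix.of (u.2.2 : Fin n → Fin n → ℝ)) * χ := by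
    rw [← antiInvOfBlocks_eq (SymplecticGroup.symplectic_det hm)]
    change (ψ : Mat n)⁻¹ * R n * ψ = _
    rw [h1, Matrix.mul_inv_rev]
    simp only [Matrix.mul_assoc]
  rw [h3]
  rfl

/-- The local section of `ψ ↦ ψ⁻¹ R ψ` around `χ⁻¹ R χ`. -/
noncomputable def conjRSection (χ : Sp n) (S : AntiInv n) : Sp n :=
  invFun (fun ψ : Sp n => entries n (ψ : Mat n))
    -- The section takes `δ = 1`. It is meaningful only for `S` in the domain of `antiChart χ`.
    ((spChart χ).par (Matrix.of.symm 1, (antiChart χ).ret (entries n (S : Mat n))))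

theorem one_mem_spChart_U {χ : Sp n} {u : AntiModel n} (hu : u ∈ (antiChart χ).U) :
    ((Matrix.of.symm 1, u) : SpModel n) ∈ (spChart χ).U :=
  ⟨by simp, hu⟩

theorem entries_conjRSection {χ : Sp n} {S : AntiInv n}
    (hS : entries n (S : Mat n) ∈ (antiChart χ).dom) :
    entries n (conjRSection χ S : Mat n) =
      (spChart χ).par (Matrix.of.symm 1, (antiChart χ).ret (entries n (S : Mat n))) :=
  (spChart χ).ι_invFun_par (one_mem_spChart_U ((antiChart χ).ret_mem S hS))

theorem conjR_conjRSection {χ : Sp n} {S : AntiInv n}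
    (hS : entries n (S : Mat n) ∈ (antiChart χ).dom) : conjR (conjRSection χ S) = S :=
  (isEmbedding_antiInv n).injective <|
    (entries_conjR_of_eq_par (one_mem_spChart_U ((antiChart χ).ret_mem S hS))
      (entries_conjRSection hS)).trans ((antiChart χ).par_ret S hS)

theorem eventually_mem_antiChart_dom (χ : Sp n) :
    ∀ᶠ S : AntiInv n in 𝓝 (conjR χ), entries n (S : Mat n) ∈ (antiChart χ).dom :=
  ((antiChart χ).isOpen_dom.preimage (isEmbedding_antiInv n).continuous).mem_nhds
    (mem_antiChart_dom χ)

/-- `ret_mem` controls `ret` only at points of `𝒜(n)`; at other matrices, landing in `U` has to be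
imposed. -/
theorem contDiffOn_spChart_par_one (χ : Sp n) :
    ContDiffOn ℝ ∞ (fun v => (spChart χ).par (Matrix.of.symm 1, (antiChart χ).ret v))
      ((antiChart χ).dom ∩ (antiChart χ).ret ⁻¹' (antiChart χ).U) :=
  (spChart χ).contDiffOn_par.comp
    (contDiffOn_const.prodMk ((antiChart χ).contDiffOn_ret.mono Set.inter_subset_left))
    fun _ h => one_mem_spChart_U h.2

theorem contDiffAt_spChart_par_one (χ : Sp n) :
    ContDiffAt ℝ ∞ (fun v => (spChart χ).par (Matrix.of.symm 1, (antiChart χ).ret v))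
      (entries n (conjR χ : Mat n)) := by
  refine (contDiffOn_spChart_par_one χ).contDiffAt (IsOpen.mem_nhds ?_ ⟨mem_antiChart_dom χ, ?_⟩)
  · exact (antiChart χ).contDiffOn_ret.continuousOn.isOpen_inter_preimage (antiChart χ).isOpen_dom
      (antiChart χ).isOpen_U
  · exact (antiChart χ).ret_mem (conjR χ) (mem_antiChart_dom χ)

theorem continuousAt_conjRSection (χ : Sp n) : ContinuousAt (conjRSection χ) (conjR χ) := by
  rw [(isEmbedding_sp n).isInducing.continuousAt_iff]
  have h := (contDiffAt_spChart_par_one χ).continuousAt.comp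
    (f := fun S : AntiInv n => entries n (S : Mat n)) (isEmbedding_antiInv n).continuous.continuousAt
  refine h.congr ?_
  filter_upwards [eventually_mem_antiChart_dom χ] with S hS
  exact (entries_conjRSection hS).symm

theorem continuous_proj (n : ℕ) : Continuous (proj n) := continuous_quotient_mk'

theorem proj_surjective (n : ℕ) : Surjective (proj n) := Quotient.mk_surjective

theorem proj_eq_iff_conjR (ψ χ : Sp n) : proj n ψ = proj n χ ↔ conjR ψ = conjR χ := by
  rw [proj_eq_iff, Subtype.ext_iff]
  rfl

theorem conjR_surjective (n : ℕ) : Surjective (conjR (n := n)) := fun S =>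
  (exists_sp_conj S.2).imp fun _ h => Subtype.ext h.symm

/-- The bijection `Gl(n, ℝ) ψ ↦ ψ⁻¹ R ψ`. -/
noncomputable def cosetEquiv (n : ℕ) : HomSpace n ≃ AntiInv n :=
  Equiv.ofBijective (Quotient.lift conjR fun ψ χ h =>
      (proj_eq_iff_conjR ψ χ).1 (Quotient.sound h))
    ⟨fun x y h => by
      obtain ⟨ψ, rfl⟩ := proj_surjective n x
      obtain ⟨χ, rfl⟩ := proj_surjective n y
      exact (proj_eq_iff_conjR ψ χ).2 h,
    fun S => by
      obtain ⟨ψ, rfl⟩ := conjR_surjective n S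
      exact ⟨proj n ψ, rfl⟩⟩

theorem cosetEquiv_proj (ψ : Sp n) : cosetEquiv n (proj n ψ) = conjR ψ := rfl

/-- Through this local formula the inverse bijection inherits continuity, and later smoothness, from
the section. -/
theorem cosetEquiv_symm_eventuallyEq (χ : Sp n) :
    (cosetEquiv n).symm =ᶠ[𝓝 (conjR χ)] proj n ∘ conjRSection χ := by
  filter_upwards [eventually_mem_antiChart_dom χ] with S hS
  rw [Equiv.symm_apply_eq, Function.comp_apply, cosetEquiv_proj, conjR_conjRSection hS]

/-- The homeomorphism `Gl(n, ℝ) ψ ↦ ψ⁻¹ R ψ`. -/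
noncomputable def cosetHomeomorph (n : ℕ) : HomSpace n ≃ₜ AntiInv n where
  toEquiv := cosetEquiv n
  continuous_toFun := (continuous_conjR n).quotient_lift _
  continuous_invFun := by
    refine continuous_iff_continuousAt.2 fun S => ?_
    obtain ⟨χ, rfl⟩ := conjR_surjective n S
    exact ((continuous_proj n).continuousAt.comp (continuousAt_conjRSection χ)).congr
      (cosetEquiv_symm_eventuallyEq χ).symm

/-- This places the quotient topology inside the space of matrices, so that slice charts apply to
the coset space. -/
theorem isEmbedding_homSpace (n : ℕ) :
    IsEmbedding fun x : HomSpace n => entries n (cosetEquiv n x : Mat n) :=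
  (isEmbedding_antiInv n).comp (cosetHomeomorph n).isEmbedding

/-- The involution `R` as an invertible matrix. -/
noncomputable def RUnit (n : ℕ) : (Mat n)ˣ := ⟨R n, R n, R_mul_R n, R_mul_R n⟩

/-- The slice chart of `Sp^R(n)` that corresponds to the one of `𝒜(n)` around `χ⁻¹ R χ`. -/
noncomputable def spRChart (χ : Sp n) :
    SliceChart (fun ψ : SpR n => entries n (ψ : Mat n)) (AntiModel n) :=
  (antiChart χ).comap (mulMul (RUnit n) 1)
    (fun ψ => ⟨⟨_, (mem_SpR_iff n _).1 ψ.2⟩, by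
      rw [mulMul_entries, Units.val_one, Matrix.mul_one]; rfl⟩)
    (fun S => ⟨⟨R n * S, (mem_SpR_iff n _).2 (by
        rw [← Matrix.mul_assoc, R_mul_R, Matrix.one_mul]; exact S.2)⟩, by
      rw [mulMul_entries, Units.val_one, Matrix.mul_one]
      change entries n (R n * (R n * S)) = _
      rw [← Matrix.mul_assoc, R_mul_R, Matrix.one_mul]⟩)

/-- The slice chart of `Gl(n, ℝ) \ Sp(n)` that corresponds to the one of `𝒜(n)` around
`χ⁻¹ R χ`. -/
noncomputable def homSpaceChart (χ : Sp n) :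
    SliceChart (fun x : HomSpace n => entries n (cosetEquiv n x : Mat n)) (AntiModel n) :=
  (antiChart χ).comap (.refl ℝ _) (fun x => ⟨cosetEquiv n x, rfl⟩)
    (fun S => ⟨(cosetEquiv n).symm S, by simp⟩)

end Quotient

/-! ### Existence of the structures, and the diffeomorphisms for arbitrary ones. -/

/-- A family of slice charts modelled on Euclidean space is an embedded submanifold structure. -/
theorem isSubmanifoldStructure_chartedSpace {n d : ℕ} {X T : Type} [TopologicalSpace X]
    [Nonempty X] {ι : X → Mat n} (hι : IsEmbedding fun x => entries n (ι x))
    (c : T → SliceChart (fun x => entries n (ι x)) (EuclideanSpace ℝ (Fin d))) (rep : X → T)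
    (h : ∀ x, entries n (ι x) ∈ (c (rep x)).dom) :
    IsSubmanifoldStructure ι (SliceChart.chartedSpace hι c rep h) :=
  letI := SliceChart.chartedSpace hι c rep h
  ⟨SliceChart.isManifold hι c rep h, SliceChart.isSmoothEmbedding hι c rep h⟩

/-- A finite-dimensional space is isomorphic to Euclidean space. -/
noncomputable def euclideanEquiv (E : Type) [NormedAddCommGroup E] [NormedSpace ℝ E]
    [FiniteDimensional ℝ E] : E ≃L[ℝ] EuclideanSpace ℝ (Fin (finrank ℝ E)) :=
  ContinuousLinearEquiv.ofFinrankEq (by simp)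

theorem exists_smooth_structures (n : ℕ) :
    ∃ (dS dR dA dQ : ℕ)
      (cS : ChartedSpace (EuclideanSpace ℝ (Fin dS)) (Sp n))
      (cR : ChartedSpace (EuclideanSpace ℝ (Fin dR)) (SpR n))
      (cA : ChartedSpace (EuclideanSpace ℝ (Fin dA)) (AntiInv n))
      (cQ : ChartedSpace (EuclideanSpace ℝ (Fin dQ)) (HomSpace n)),
      IsSubmanifoldStructure (fun ψ : Sp n => (ψ : Mat n)) cS ∧
      IsSubmanifoldStructure (fun ψ : SpR n => (ψ : Mat n)) cR ∧
      IsSubmanifoldStructure (fun S : AntiInv n => (S : Mat n)) cA ∧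
      IsQuotientStructure cS cQ := by
  let LS := euclideanEquiv (SpModel n)
  let LA := euclideanEquiv (AntiModel n)
  have hR : ∀ ψ : SpR n, ∃ χ : Sp n, entries n (ψ : Mat n) ∈ ((spRChart χ).trans LA).dom := by
    intro ψ
    obtain ⟨χ, hχ⟩ := exists_sp_conj ((mem_SpR_iff n _).1 ψ.2)
    refine ⟨χ, ?_⟩
    change mulMul (RUnit n) 1 (entries n (ψ : Mat n)) ∈ (antiChart χ).dom
    rw [mulMul_entries, Units.val_one, Matrix.mul_one]
    change entries n (R n * ψ) ∈ _
    rw [hχ]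
    exact mem_antiChart_dom χ
  have hA : ∀ S : AntiInv n, ∃ χ : Sp n, entries n (S : Mat n) ∈ ((antiChart χ).trans LA).dom := by
    intro S
    obtain ⟨χ, rfl⟩ := conjR_surjective n S
    exact ⟨χ, mem_antiChart_dom χ⟩
  have hQ : ∀ x : HomSpace n, ∃ χ : Sp n,
      entries n (cosetEquiv n x : Mat n) ∈ ((homSpaceChart χ).trans LA).dom := by
    intro x
    obtain ⟨χ, rfl⟩ := proj_surjective n x
    exact ⟨χ, mem_antiChart_dom χ⟩
  choose repR hR using hR
  choose repA hA using hA
  choose repQ hQ using hQ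
  have hS : ∀ ψ : Sp n, entries n (ψ : Mat n) ∈ ((spChart ψ).trans LS).dom := mem_spChart_dom
  let cS := SliceChart.chartedSpace (isEmbedding_sp n) (fun χ => (spChart χ).trans LS) id hS
  let cQ := SliceChart.chartedSpace (isEmbedding_homSpace n)
    (fun χ => (homSpaceChart χ).trans LA) repQ hQ
  have mS : IsManifold 𝓘(ℝ, EuclideanSpace ℝ (Fin (finrank ℝ (SpModel n)))) ∞ (Sp n) :=
    SliceChart.isManifold (isEmbedding_sp n) (fun χ => (spChart χ).trans LS) id hS
  have mQ : IsManifold 𝓘(ℝ, EuclideanSpace ℝ (Fin (finrank ℝ (AntiModel n)))) ∞ (HomSpace n) :=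
    SliceChart.isManifold (isEmbedding_homSpace n) (fun χ => (homSpaceChart χ).trans LA) repQ hQ
  refine ⟨_, _, _, _, cS, _, _, cQ,
    isSubmanifoldStructure_chartedSpace (isEmbedding_sp n) (fun χ => (spChart χ).trans LS) id hS,
    isSubmanifoldStructure_chartedSpace (isEmbedding_spR n) (fun χ => (spRChart χ).trans LA) _ hR,
    isSubmanifoldStructure_chartedSpace (isEmbedding_antiInv n) (fun χ => (antiChart χ).trans LA)
      _ hA, ⟨mQ, ?_⟩⟩
  refine Manifold.IsSubmersionOfComplement.isSubmersion (F := Fin n → Fin n → ℝ) fun χ => ?_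
  refine Manifold.IsSubmersionAtOfComplement.mk_of_continuousAt
    (continuous_proj n).continuousAt
    -- The splitting is `w ↦ ((B, C), δ)`; the complement of the submersion is the space of `δ`.
    ((LS.symm.trans (ContinuousLinearEquiv.prodComm ℝ _ _)).trans
      (LA.prodCongr (ContinuousLinearEquiv.refl ℝ _)))
    (((spChart χ).trans LS).chart (isEmbedding_sp n))
    (((homSpaceChart χ).trans LA).chart (isEmbedding_homSpace n))
    (hS χ) (mem_antiChart_dom χ)
    (IsManifold.chart_mem_maximalAtlas χ)
    -- The chart chosen at `proj n χ` may belong to another representative, so the one labelled `χ`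
    -- is used as a member of the atlas.
    (IsManifold.subset_maximalAtlas ⟨χ, rfl⟩) ?_
  intro w hw
  have hw₀ : w ∈ (((spChart χ).trans LS).chart (isEmbedding_sp n)).target := by simpa using hw
  have hw' : w ∈ ((spChart χ).trans LS).U := hw₀
  have hψ := ((spChart χ).trans LS).ι_invFun_par hw'
  have hu : LS.symm w ∈ (spChart χ).U := hw'
  have h1 := entries_conjR_of_eq_par hu hψ
  change LA ((antiChart χ).ret (entries n (conjR (invFun (fun ψ : Sp n => entries n (ψ : Mat n))
    (((spChart χ).trans LS).par w)) : Mat n))) = LA (LS.symm w).2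
  rw [h1, (antiChart χ).ret_par _ hu.2]

theorem exists_diffeomorphs (n dS dR dA dQ : ℕ)
    (cS : ChartedSpace (EuclideanSpace ℝ (Fin dS)) (Sp n))
    (cR : ChartedSpace (EuclideanSpace ℝ (Fin dR)) (SpR n))
    (cA : ChartedSpace (EuclideanSpace ℝ (Fin dA)) (AntiInv n))
    (cQ : ChartedSpace (EuclideanSpace ℝ (Fin dQ)) (HomSpace n))
    (hS : IsSubmanifoldStructure (fun ψ : Sp n => (ψ : Mat n)) cS)
    (hR : IsSubmanifoldStructure (fun ψ : SpR n => (ψ : Mat n)) cR)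
    (hA : IsSubmanifoldStructure (fun S : AntiInv n => (S : Mat n)) cA)
    (hQ : IsQuotientStructure cS cQ) :
    (∃ Φ : Diffeomorph (𝓡 dR) (𝓡 dA) (SpR n) (AntiInv n) ∞,
      ∀ ψ : SpR n, (Φ ψ : Mat n) = R n * (ψ : Mat n)) ∧
    (∃ Ψ : Diffeomorph (𝓡 dQ) (𝓡 dA) (HomSpace n) (AntiInv n) ∞,
      ∀ ψ : Sp n, (Ψ (proj n ψ) : Mat n) = (ψ : Mat n)⁻¹ * R n * (ψ : Mat n)) := by
  have iS := hS.isSmoothEmbedding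
  have iR := hR.isSmoothEmbedding
  have iA := hA.isSmoothEmbedding
  have hmul : ∀ M : Mat n, mulMul (RUnit n) 1 (entries n M) = entries n (R n * M) := fun M => by
    rw [mulMul_entries, Units.val_one, Matrix.mul_one]; rfl
  have hRR : ∀ M : Mat n, R n * (R n * M) = M := fun M => by
    rw [← Matrix.mul_assoc, R_mul_R, Matrix.one_mul]
  constructor
  · let Φ : SpR n ≃ AntiInv n :=
      { toFun ψ := ⟨R n * ψ, (mem_SpR_iff n _).1 ψ.2⟩
        invFun S := ⟨R n * S, (mem_SpR_iff n _).2 (by rw [hRR]; exact S.2)⟩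
        left_inv ψ := Subtype.ext (hRR _)
        right_inv S := Subtype.ext (hRR _) }
    -- In ambient coordinates both directions are the linear map `M ↦ R M`; the immersions `iA` and
    -- `iR` bring smoothness back to the submanifolds.
    have h1 : ContMDiff (𝓡 dR) 𝓘(ℝ, Entries n) ∞ fun ψ => entries n (Φ ψ : Mat n) :=
      ((mulMul (RUnit n) 1).contDiff.contMDiff.comp iR.contMDiff).congr fun ψ => (hmul _).symm
    have h2 : ContMDiff (𝓡 dA) 𝓘(ℝ, Entries n) ∞ fun S => entries n (Φ.symm S : Mat n) :=
      ((mulMul (RUnit n) 1).contDiff.contMDiff.comp iA.contMDiff).congr fun S => (hmul _).symm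
    exact ⟨⟨Φ,
      (ContMDiff.iff_comp_isImmersion iA.isImmersion).2
        ⟨(isEmbedding_antiInv n).continuous_iff.2 h1.continuous, h1⟩,
      (ContMDiff.iff_comp_isImmersion iR.isImmersion).2
        ⟨(isEmbedding_spR n).continuous_iff.2 h2.continuous, h2⟩⟩, fun _ => rfl⟩
  · have h1 : ContMDiff (𝓡 dS) (𝓡 dA) ∞ (conjR (n := n)) :=
      (ContMDiff.iff_comp_isImmersion iA.isImmersion).2 ⟨continuous_conjR n,
        ((contDiff_conjRPoly n).contMDiff.comp iS.contMDiff).congr entries_conjR⟩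
    have h2 : ContMDiff (𝓡 dQ) (𝓡 dA) ∞ (cosetEquiv n) :=
      hQ.isSubmersion.contMDiff_of_comp (proj_surjective n) h1
    have h3 : ContMDiff (𝓡 dA) (𝓡 dQ) ∞ (cosetEquiv n).symm := by
      intro S
      obtain ⟨χ, rfl⟩ := conjR_surjective n S
      -- The entries of the section are a smooth function of the entries of `S`, and smoothness into
      -- `Sp(n)` is tested on entries.
      have h4 : ContMDiffAt (𝓡 dA) (𝓡 dS) ∞ (conjRSection χ) (conjR χ) := by
        refine (ContMDiffAt.iff_comp_isImmersionAt (iS.isImmersion.isImmersionAt _)).2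
          ⟨continuousAt_conjRSection χ, ?_⟩
        have h5 := ((contDiffAt_spChart_par_one χ).contMDiffAt).comp (conjR χ)
          (iA.contMDiff.contMDiffAt (x := conjR χ))
        refine h5.congr_of_eventuallyEq ?_
        filter_upwards [eventually_mem_antiChart_dom χ] with S hS
        exact entries_conjRSection hS
      exact (hQ.isSubmersion.contMDiff.contMDiffAt.comp _ h4).congr_of_eventuallyEq
        (cosetEquiv_symm_eventuallyEq χ)
    exact ⟨⟨cosetEquiv n, h2, h3⟩, fun _ => rfl⟩

end

/-- First, `Gl(n, ℝ)` is embedded in `Sp(n)` as the group of symplectic matrices commuting with `R`.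
Second, the smooth structures of the spaces exist. Third, for these structures `ψ ↦ Rψ` is a
diffeomorphism `Sp^R(n) → 𝒜(n)`, and `Gl(n, ℝ) ψ ↦ ψ⁻¹Rψ` is a diffeomorphism
`Gl(n, ℝ) \ Sp(n) → 𝒜(n)`. -/
theorem theorem1 (n : ℕ) :
    (Function.Injective (glHom n) ∧
      ∀ ψ : Sp n, ψ ∈ GlSub n ↔ R n * (ψ : Mat n) = (ψ : Mat n) * R n) ∧
    (∃ (dS dR dA dQ : ℕ)
      (cS : ChartedSpace (EuclideanSpace ℝ (Fin dS)) (Sp n))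
      (cR : ChartedSpace (EuclideanSpace ℝ (Fin dR)) (SpR n))
      (cA : ChartedSpace (EuclideanSpace ℝ (Fin dA)) (AntiInv n))
      (cQ : ChartedSpace (EuclideanSpace ℝ (Fin dQ)) (HomSpace n)),
      IsSubmanifoldStructure (fun ψ : Sp n => (ψ : Mat n)) cS ∧
      IsSubmanifoldStructure (fun ψ : SpR n => (ψ : Mat n)) cR ∧
      IsSubmanifoldStructure (fun S : AntiInv n => (S : Mat n)) cA ∧
      IsQuotientStructure cS cQ) ∧
    (∀ (dS dR dA dQ : ℕ)
      (cS : ChartedSpace (EuclideanSpace ℝ (Fin dS)) (Sp n))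
      (cR : ChartedSpace (EuclideanSpace ℝ (Fin dR)) (SpR n))
      (cA : ChartedSpace (EuclideanSpace ℝ (Fin dA)) (AntiInv n))
      (cQ : ChartedSpace (EuclideanSpace ℝ (Fin dQ)) (HomSpace n)),
      IsSubmanifoldStructure (fun ψ : Sp n => (ψ : Mat n)) cS →
      IsSubmanifoldStructure (fun ψ : SpR n => (ψ : Mat n)) cR →
      IsSubmanifoldStructure (fun S : AntiInv n => (S : Mat n)) cA →
      IsQuotientStructure cS cQ →
      (∃ Φ : Diffeomorph (𝓡 dR) (𝓡 dA) (SpR n) (AntiInv n) ∞,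
        ∀ ψ : SpR n, (Φ ψ : Mat n) = R n * (ψ : Mat n)) ∧
      (∃ Ψ : Diffeomorph (𝓡 dQ) (𝓡 dA) (HomSpace n) (AntiInv n) ∞,
        ∀ ψ : Sp n, (Ψ (proj n ψ) : Mat n) = (ψ : Mat n)⁻¹ * R n * (ψ : Mat n))) := by
  exact ⟨⟨glHom_injective n, mem_GlSub_iff n⟩, exists_smooth_structures n,
    fun dS dR dA dQ cS cR cA cQ => exists_diffeomorphs n dS dR dA dQ cS cR cA cQ⟩
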